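/- **Setting.** Let $\lambda>0$, $\gamma\in(0,1)$, and let $s,d\in\mathbb R^2$ be the positions of a source and its destination. The relay pool $\{X_i\}_{i\in\mathbb N}$ is a homogeneous Poisson point process in the plane of intensity $(1-\gamma)\lambda$. For each channel realization $t\in\mathbb N$ the interferers $\{Y^t_k\}_{k\in\mathbb N}$ form a homogeneous Poisson point process of intensity $\gamma\lambda$; their joint law over different $t$ is arbitrary. For each $t$, each transmitter $u$ (source, relay or interferer) and each receiver $v$ (relay or destination) let $h^t_{uv}$ be the fading of the link $u\to v$; all the $h^t_{uv}$ are i.i.d. with an arbitrary law on an arbitrary measurable space. The sequence $(X_i)$, the array $(Y^t_k)$ and the family $(h^t_{uv})$ are independent. A channel model is an arbitrary measurable rule which decides whether a hop $u\to v$ (with $u$ the source or a relay) succeeds in realization $t$ from the positions of $u$ and $v$, the fading $h^t_{uv}$, and the interferers as seen from $v$, $(Y^t_k,h^t_{kv})_{k\in\mathbb N}$. An example is the rule $|h_{uv}|^2r_{uv}^{-\alpha}\ge\beta\sum_k|h_{kv}|^2r_{kv}^{-\alpha}$, i.e. $\mathrm{SIR}\ge\beta$; another is independent links that succeed with a prescribed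 probability $g_0(r_{uv})$, where $r_{uv}$ is the distance from $u$ to $v$. Let $m\ge1$, let $F\subseteq(\mathbb R^2)^m$ be a measurable feasible region (e.g. everything), and let hop $l\in\{0,\dots,m\}$ of a route use the channel realization $\tau(l)\in\mathbb N$, for an arbitrary map $\tau$ (constant: the same channel for all hops; injective: a fresh one for each hop). An ordered $m$-tuple of distinct relays is a *potential relay set* if its location vector lies in $F$ and all $m+1$ hops source $\to$ first relay $\to\cdots\to$ $m$-th relay $\to$ destination succeed. Let $N_m\in\{0,1,\dots,\infty\}$ be the number of potential relay sets, and let $p_{\mathrm{out}}^{(m)}=\mathbb P(\text{there is no potential relay set})$ be the end-to-end outage probability. **Theorem 1.** For every channel model, $$p_{\mathrm{out}}^{(m)}\ \ge\ \exp\bigl(-\mathbb E[N_m]\bigr),$$ where $\exp(-\infty)=0$ if $\mathbb E[N_m]=\infty$. -/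

import Mathlib

open MeasureTheory ProbabilityTheory
open scoped ENNReal NNReal

noncomputable section

/-- The Euclidean plane. -/
abbrev Plane : Type := EuclideanSpace ℝ (Fin 2)

/-- Number of points of the enumerated random point set `(X i)` that lie in `B`. -/
def pointCount {Ω : Type*} (X : ℕ → Ω → Plane) (B : Set Plane) (ω : Ω) : ℕ∞ :=
  {i : ℕ | X i ω ∈ B}.encard

/-- The enumerated random points `X 0, X 1, …` form a homogeneous Poisson point process in the
plane of intensity `c > 0` (such a process almost surely has infinitely many points). -/
structure IsHPPP {Ω : Type*} [MeasurableSpace Ω] (P : Measure Ω) (X : ℕ → Ω → Plane) (c : ℝ) :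
    Prop where
  measurable : ∀ i, Measurable (X i)
  count_law : ∀ B : Set Plane, MeasurableSet B → volume B ≠ ∞ → ∀ n : ℕ,
    P {ω | pointCount X B ω = n} = poissonMeasure (Real.toNNReal (c * volume.real B)) {n}
  count_indep : ∀ (n : ℕ) (B : Fin n → Set Plane), (∀ j, MeasurableSet (B j)) →
    (∀ j, volume (B j) ≠ ∞) → (∀ j k, j ≠ k → Disjoint (B j) (B k)) →
    iIndepFun (fun j => pointCount X (B j)) P

/-- Everything that can transmit. -/
inductive Transmitter : Type
  | source : Transmitter
  | relay (i : ℕ) : Transmitter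
  | interferer (k : ℕ) : Transmitter

/-- Everything that can receive. -/
inductive Receiver : Type
  | relay (i : ℕ) : Receiver
  | destination : Receiver

/-- A channel model with fading in `H`: the rule that decides, from the position of the
transmitter, the position of the receiver, the fading of their link, and the positions of the
interferers with their fadings towards the receiver, whether a hop succeeds.
Any measurable rule is allowed. -/
structure Channel (H : Type*) [MeasurableSpace H] where
  success : Set (Plane × Plane × H × (ℕ → Plane × H))
  measurableSet_success : MeasurableSet success

/-- The signal-to-interference channel with path loss exponent `α` and threshold `β`; the fading
is the power `|h|²`. The rule is `|h|² r^(-α) ≥ β * ∑ₖ |hₖ|² rₖ^(-α)`, that is `SIR ≥ β`. -/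
def Channel.sir (α : ℝ) (β : ℝ≥0) : Channel ℝ≥0 where
  success := {p | (β : ℝ≥0∞) * ∑' k, ((p.2.2.2 k).2 : ℝ≥0∞) * edist (p.2.2.2 k).1 p.2.1 ^ (-α)
    ≤ (p.2.2.1 : ℝ≥0∞) * edist p.1 p.2.1 ^ (-α)}
  measurableSet_success := by
    apply measurableSet_le
    · refine Measurable.const_mul (Measurable.tsum fun k => ?_) _
      have h : Measurable fun p : Plane × Plane × ℝ≥0 × (ℕ → Plane × ℝ≥0) => p.2.2.2 k :=
        (measurable_pi_apply k).comp (by fun_prop)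
      exact h.snd.coe_nnreal_ennreal.mul ((h.fst.edist (by fun_prop)).pow_const _)
    · exact Measurable.mul (by fun_prop)
        ((Measurable.edist (by fun_prop) (by fun_prop)).pow_const _)

/-- The channel with prescribed per-hop success probability `g₀ r` at distance `r`, links being
independent: the fading of a link is uniform on `[0, 1]`, and a hop succeeds when it is at most
`g₀ r`. -/
def Channel.ofSuccessProb (g₀ : ℝ → ℝ) (hg : Measurable g₀) : Channel ℝ where
  success := {p | p.2.2.1 ≤ g₀ (dist p.1 p.2.1)}
  measurableSet_success := measurableSet_le (by fun_prop)
    (hg.comp (Measurable.dist (by fun_prop) (by fun_prop)))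

/-- The random objects seen by a typical source-destination pair. A channel realization is
labelled by `t : ℕ`; `interferer t k` is the position of the `k`-th interferer during realization
`t`, and `fading (t, u, v)` is the fading of the link from `u` to `v` in realization `t`. -/
structure RelayNetwork (Ω H : Type*) where
  src : Plane
  dst : Plane
  relay : ℕ → Ω → Plane
  interferer : ℕ → ℕ → Ω → Plane
  fading : ℕ × Transmitter × Receiver → Ω → H

namespace RelayNetwork

variable {Ω H : Type*} [MeasurableSpace H]

/-- The probabilistic model: the relay pool is Poisson of intensity `(1 - γ) λ`; in each channel
realization the interferers are Poisson of intensity `γ λ` (with any joint law over different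
realizations); the fadings of distinct links are i.i.d. with law `ν`; and the pool, the
interferers and the fadings are independent. -/
structure IsPoissonModel [MeasurableSpace Ω] (N : RelayNetwork Ω H) (P : Measure Ω)
    (ν : Measure H) (lam gam : ℝ) : Prop where
  relay_poisson : IsHPPP P N.relay ((1 - gam) * lam)
  interferer_poisson : ∀ t, IsHPPP P (N.interferer t) (gam * lam)
  fading_measurable : ∀ a, Measurable (N.fading a)
  fading_law : ∀ a, P.map (N.fading a) = ν
  fading_indep : iIndepFun N.fading P
  relay_indep_interferer :
    IndepFun (fun ω i => N.relay i ω) (fun ω t k => N.interferer t k ω) P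
  fading_indep_positions :
    IndepFun (fun ω a => N.fading a ω)
      (fun ω => ((fun i => N.relay i ω), (fun t k => N.interferer t k ω))) P

/-- In channel realization `t`, the hop from transmitter `u`, located at `x`, to receiver `v`,
located at `y`, succeeds. -/
def HopSucceeds (N : RelayNetwork Ω H) (C : Channel H) (t : ℕ) (u : Transmitter) (x : Plane)
    (v : Receiver) (y : Plane) (ω : Ω) : Prop :=
  (x, y, N.fading (t, u, v) ω,
    fun k => (N.interferer t k ω, N.fading (t, Transmitter.interferer k, v) ω)) ∈ C.success

/-- The `m`-tuple `r` of distinct relays is a potential relay set: its location vector lies in the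
feasible region `F`, and all `m + 1` hops
`source → r 0 → r 1 → ⋯ → r (m - 1) → destination` succeed, hop `l` using the channel
realization `τ l`. -/
def IsPotential (N : RelayNetwork Ω H) (C : Channel H) {m : ℕ} (τ : Fin (m + 1) → ℕ)
    (F : Set (Fin m → Plane)) (r : Fin m ↪ ℕ) (ω : Ω) : Prop :=
  (fun i => N.relay (r i) ω) ∈ F ∧
    ∀ l : Fin (m + 1),
      N.HopSucceeds C (τ l)
        (Fin.cons (α := fun _ => Transmitter) Transmitter.source
          (fun i => Transmitter.relay (r i)) l)
        (Fin.cons (α := fun _ => Plane) N.src (fun i => N.relay (r i) ω) l)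
        (Fin.snoc (α := fun _ => Receiver) (fun i => Receiver.relay (r i))
          Receiver.destination l)
        (Fin.snoc (α := fun _ => Plane) (fun i => N.relay (r i) ω) N.dst l) ω

/-- `N_m`: the number of potential relay sets. -/
def potentialCount (N : RelayNetwork Ω H) (C : Channel H) {m : ℕ} (τ : Fin (m + 1) → ℕ)
    (F : Set (Fin m → Plane)) (ω : Ω) : ℕ∞ :=
  {r : Fin m ↪ ℕ | N.IsPotential C τ F r ω}.encard

/-- `E(N_m)`, which may be infinite. -/
def expectedPotentialCount [MeasurableSpace Ω] (N : RelayNetwork Ω H) (P : Measure Ω)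
    (C : Channel H) {m : ℕ} (τ : Fin (m + 1) → ℕ) (F : Set (Fin m → Plane)) : ℝ≥0∞ :=
  ∫⁻ ω, ((N.potentialCount C τ F ω : ℕ∞) : ℝ≥0∞) ∂P

/-- The end-to-end outage probability: no relay set can complete forwarding. -/
def outageProb [MeasurableSpace Ω] (N : RelayNetwork Ω H) (P : Measure Ω)
    (C : Channel H) {m : ℕ} (τ : Fin (m + 1) → ℕ) (F : Set (Fin m → Plane)) : ℝ≥0∞ :=
  P {ω | ∀ r : Fin m ↪ ℕ, ¬ N.IsPotential C τ F r ω}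

end RelayNetwork

end

noncomputable section

/-! ### Product measures -/

/-! Poisson correlation inequality by discretisation. Suppose first that `F` forces all relays into
a window `B` of finite area, and let `r` be the mean number of relays there. Given that there are
`k` relays in `B`, they are i.i.d. uniform. With `a` the probability that a given ordered `m`-tuple
of uniform relays works and `q k` the outage probability with `k` of them, outage is the Poisson
mixture of the `q k`, while `E[N_m]` is the Poisson mean of `k (k-1) ⋯ (k-m+1) * a`, which is at
least `r ^ m * a`. It remains to prove `exp (-(r ^ m * a)) ≤ ∑ Poisson_r(k) q k`.

Replace the Poisson number by a binomial one: take `n` i.i.d. uniform relays and retain each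
independently with probability `p = r / n`. Freeze the environment, that is, the positions of all
`n` relays, the interferers, and the fadings from interferers. Whether a hop succeeds is then a
condition on the fading of its own link, and these fadings are i.i.d. and independent of the
retention. Each event "the route is retained and works" is increasing in independent indicators, so
by Harris–FKG the conditional outage probability is at least the product of `1 - p ^ m * P(route
works | environment)` over routes (`prod_le_sum_bernoulliWeight_mul_measureReal`). Since `1 - x ≥
exp (-x / (1 - p))` for `0 ≤ x ≤ p`, this is at least the exponential of minus a sum over routes.
Jensen's inequality averages out the environment, which is what permits an arbitrary dependence of
hops through common interference (`exp_le_sum_binomial_outageSet`). Letting `n → ∞` gives the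
Poisson bound (`exp_le_tsum_poisson_of_forall_binomial`).

The passage between labelled Poisson points and uniform points is
`IsHPPP.sum_map_restrict_enumerates`, proved by counting enumerations of the points in `B`. Finally
the window grows to the whole plane. -/

open Measure in
theorem infinitePi_sum_map_prod {α β H : Type*} [MeasurableSpace H] (ν : Measure H)
    [IsProbabilityMeasure ν] :
    (infinitePi fun _ : α ⊕ β => ν).map (fun f => (fun a => f (.inl a), fun b => f (.inr b))) =
      (infinitePi fun _ : α => ν).prod (infinitePi fun _ : β => ν) := by
  have hm : Measurable fun g : (α → H) × (β → H) => (Sum.elim g.1 g.2 : α ⊕ β → H) := by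
    refine measurable_pi_iff.2 fun c => ?_
    cases c with
    | inl a => exact (measurable_pi_apply a).comp measurable_fst
    | inr b => exact (measurable_pi_apply b).comp measurable_snd
  -- An infinite product is characterised by its values on finite boxes, so the law is identified
  -- after gluing the two families; splitting inverts the gluing.
  have key : ((infinitePi fun _ : α => ν).prod (infinitePi fun _ : β => ν)).map
      (fun g => (Sum.elim g.1 g.2 : α ⊕ β → H)) = infinitePi fun _ : α ⊕ β => ν := by
    refine eq_infinitePi _ fun s t ht => ?_
    rw [map_apply hm (MeasurableSet.pi s.countable_toSet fun i _ => ht i)]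
    have : (fun g : (α → H) × (β → H) => (Sum.elim g.1 g.2 : α ⊕ β → H)) ⁻¹' (Set.pi s t) =
        (Set.pi (s.toLeft : Set α) fun a => t (.inl a)) ×ˢ
          (Set.pi (s.toRight : Set β) fun b => t (.inr b)) := by
      ext g
      simp [Set.mem_pi]
    rw [this, prod_prod, infinitePi_pi _ fun i _ => ht _, infinitePi_pi _ fun i _ => ht _]
    conv_rhs => rw [← s.toLeft_disjSum_toRight, Finset.prod_disjSum]
  rw [← key, map_map (by fun_prop) hm]
  exact map_id

/-- Under independent coordinates, two families of coordinates picked by injections with disjoint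
ranges are independent. -/
theorem infinitePi_map_prodMk_of_disjoint {α β γ H : Type*} [MeasurableSpace H] (ν : Measure H)
    [IsProbabilityMeasure ν] {f : α → γ} {g : β → γ} (hf : f.Injective) (hg : g.Injective)
    (hfg : ∀ a b, f a ≠ g b) :
    (Measure.infinitePi fun _ : γ => ν).map (fun h => (fun a => h (f a), fun b => h (g b))) =
      (Measure.infinitePi fun _ : α => ν).prod (Measure.infinitePi fun _ : β => ν) := by
  have hinj : (Sum.elim f g).Injective := hf.sumElim hg hfg
  rw [← infinitePi_sum_map_prod,
    ← Measure.map_infinitePi_infinitePi_of_inj (P := fun _ : γ => ν) hinj,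
    Measure.map_map (by fun_prop) (by fun_prop)]
  rfl

/-! ### Configurations of labelled relays -/

/-- Positions of relays labelled by `ι`, positions of the interferers, and fadings of the links
from the interferers. Receivers are relays, or the destination `none`. -/
abbrev Environment (H ι : Type*) : Type _ :=
  (ι → Plane) × (ℕ → ℕ → Plane) × (ℕ × ℕ × Option ι → H)

/-- An environment with the fadings of the links from the source `none` and from the relays. -/
abbrev Configuration (H ι : Type*) : Type _ :=
  Environment H ι × (ℕ × Option ι × Option ι → H)

/-- The configuration of relays relabelled along `e`. -/
def Configuration.pull {H ι κ : Type*} (e : κ → ι) (c : Configuration H ι) : Configuration H κ :=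
  ((fun j => c.1.1 (e j), c.1.2.1, fun a => c.1.2.2 (a.1, a.2.1, a.2.2.map e)),
    fun a => c.2 (a.1, a.2.1.map e, a.2.2.map e))

/-- The environment with positions of law `ρ`, interferers of law `Q`, and i.i.d. fadings of
law `ν`. -/
def environmentLaw {H ι : Type*} [MeasurableSpace H] (ρ : Measure (ι → Plane))
    (Q : Measure (ℕ → ℕ → Plane)) (ν : Measure H) [IsProbabilityMeasure ν] :
    Measure (Environment H ι) :=
  ρ.prod (Q.prod (Measure.infinitePi fun _ => ν))

/-- The configuration with positions of law `ρ`, interferers of law `Q`, and i.i.d. fadings of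
law `ν`. -/
def configurationLaw {H ι : Type*} [MeasurableSpace H] (ρ : Measure (ι → Plane))
    (Q : Measure (ℕ → ℕ → Plane)) (ν : Measure H) [IsProbabilityMeasure ν] :
    Measure (Configuration H ι) :=
  (environmentLaw ρ Q ν).prod (Measure.infinitePi fun _ => ν)

section ConfigurationLaw

variable {H ι κ : Type*} [MeasurableSpace H]

instance environmentLaw.instIsProbabilityMeasure (ρ : Measure (ι → Plane)) [IsProbabilityMeasure ρ]
    (Q : Measure (ℕ → ℕ → Plane)) [IsProbabilityMeasure Q]
    (ν : Measure H) [IsProbabilityMeasure ν] : IsProbabilityMeasure (environmentLaw ρ Q ν) := by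
  unfold environmentLaw; infer_instance

instance configurationLaw.instIsProbabilityMeasure (ρ : Measure (ι → Plane))
    [IsProbabilityMeasure ρ] (Q : Measure (ℕ → ℕ → Plane)) [IsProbabilityMeasure Q]
    (ν : Measure H) [IsProbabilityMeasure ν] : IsProbabilityMeasure (configurationLaw ρ Q ν) := by
  unfold configurationLaw; infer_instance

theorem Configuration.measurable_pull (e : κ → ι) :
    Measurable (Configuration.pull e : Configuration H ι → Configuration H κ) := by
  unfold Configuration.pull
  refine Measurable.prodMk (Measurable.prodMk ?_ (Measurable.prodMk ?_ ?_)) ?_ <;> fun_prop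

/-- Relabelling along an injection only changes the law of the positions. -/
theorem map_pull_configurationLaw {e : κ → ι} (he : e.Injective) (ρ : Measure (ι → Plane))
    [IsFiniteMeasure ρ] (Q : Measure (ℕ → ℕ → Plane)) [IsProbabilityMeasure Q] (ν : Measure H)
    [IsProbabilityMeasure ν] :
    (configurationLaw ρ Q ν).map (Configuration.pull e) =
      configurationLaw (ρ.map fun x j => x (e j)) Q ν := by
  have hw : (Measure.infinitePi fun _ : ℕ × ℕ × Option ι => ν).map
      (fun w (a : ℕ × ℕ × Option κ) => w (a.1, a.2.1, a.2.2.map e)) =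
      Measure.infinitePi fun _ => ν := by
    refine Measure.map_infinitePi_infinitePi_of_inj (P := fun _ : ℕ × ℕ × Option ι => ν)
      (f := fun a : ℕ × ℕ × Option κ => (a.1, a.2.1, a.2.2.map e)) fun a b h => ?_
    simp only [Prod.mk.injEq] at h
    exact Prod.ext h.1 (Prod.ext h.2.1 (Option.map_injective he h.2.2))
  have hl : (Measure.infinitePi fun _ : ℕ × Option ι × Option ι => ν).map
      (fun w (a : ℕ × Option κ × Option κ) => w (a.1, a.2.1.map e, a.2.2.map e)) =
      Measure.infinitePi fun _ => ν := by
    refine Measure.map_infinitePi_infinitePi_of_inj (P := fun _ : ℕ × Option ι × Option ι => ν)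
      (f := fun a : ℕ × Option κ × Option κ => (a.1, a.2.1.map e, a.2.2.map e)) fun a b h => ?_
    simp only [Prod.mk.injEq] at h
    exact Prod.ext h.1 (Prod.ext (Option.map_injective he h.2.1) (Option.map_injective he h.2.2))
  have hx : Measurable fun (x : ι → Plane) j => x (e j) := by fun_prop
  unfold configurationLaw environmentLaw
  conv_rhs => rw [← hw, ← hl]; rw [← Measure.map_id (μ := Q)]
  rw [Measure.map_prod_map _ _ measurable_id (by fun_prop),
    Measure.map_prod_map _ _ hx (by fun_prop), Measure.map_prod_map _ _ (by fun_prop) (by fun_prop)]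
  rfl

theorem map_pull_configurationLaw_infinitePi {e : κ → ι} (he : e.Injective) (u : Measure Plane)
    [IsProbabilityMeasure u] (Q : Measure (ℕ → ℕ → Plane)) [IsProbabilityMeasure Q] (ν : Measure H)
    [IsProbabilityMeasure ν] :
    (configurationLaw (Measure.infinitePi fun _ => u) Q ν).map (Configuration.pull e) =
      configurationLaw (Measure.infinitePi fun _ => u) Q ν := by
  rw [map_pull_configurationLaw he,
    Measure.map_infinitePi_infinitePi_of_inj (P := fun _ : ι => u) he]

end ConfigurationLaw

/-! ### The law of the configuration of a network -/

namespace RelayNetwork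

variable {Ω H : Type*} [MeasurableSpace H]

/-- The transmitter labelled by an optional relay, `none` being the source. -/
def transmitterOf : Option ℕ → Transmitter
  | none => .source
  | some i => .relay i

/-- The receiver labelled by an optional relay, `none` being the destination. -/
def receiverOf : Option ℕ → Receiver
  | none => .destination
  | some i => .relay i

/-- The configuration of all relays of the network. -/
def configuration (N : RelayNetwork Ω H) (ω : Ω) : Configuration H ℕ :=
  ((fun i => N.relay i ω, fun t k => N.interferer t k ω,
      fun a => N.fading (a.1, .interferer a.2.1, receiverOf a.2.2) ω),
    fun a => N.fading (a.1, transmitterOf a.2.1, receiverOf a.2.2) ω)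

theorem receiverOf_injective : Function.Injective receiverOf := by
  rintro (_ | i) (_ | j) h <;> simp_all [receiverOf]

theorem transmitterOf_injective : Function.Injective transmitterOf := by
  rintro (_ | i) (_ | j) h <;> simp_all [transmitterOf]

variable [MeasurableSpace Ω] {N : RelayNetwork Ω H} {P : Measure Ω} {ν : Measure H} {lam gam : ℝ}

theorem IsPoissonModel.measurable_configuration (hN : N.IsPoissonModel P ν lam gam) :
    Measurable N.configuration := by
  have h1 := hN.relay_poisson.measurable
  have h2 := fun t => (hN.interferer_poisson t).measurable
  have h3 := hN.fading_measurable
  unfold configuration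
  refine Measurable.prodMk (Measurable.prodMk ?_ (Measurable.prodMk ?_ ?_)) ?_
  · exact measurable_pi_iff.2 h1
  · exact measurable_pi_iff.2 fun t => measurable_pi_iff.2 (h2 t)
  · exact measurable_pi_iff.2 fun a => h3 _
  · exact measurable_pi_iff.2 fun a => h3 _

/-- The fadings from interferers and those from the source and the relays are read off disjoint sets
of indices of one i.i.d. family, hence are independent. This makes the direct links independent of
the environment; the rest reorders the factors of a product measure. -/
theorem IsPoissonModel.map_configuration [IsProbabilityMeasure P] [IsProbabilityMeasure ν]
    (hN : N.IsPoissonModel P ν lam gam) :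
    P.map N.configuration =
      configurationLaw (P.map fun ω i => N.relay i ω) (P.map fun ω t k => N.interferer t k ω) ν := by
  have h1 : Measurable fun ω i => N.relay i ω := measurable_pi_iff.2 hN.relay_poisson.measurable
  have h2 : Measurable fun ω t k => N.interferer t k ω :=
    measurable_pi_iff.2 fun t => measurable_pi_iff.2 (hN.interferer_poisson t).measurable
  have h3 : Measurable fun ω a => N.fading a ω := measurable_pi_iff.2 hN.fading_measurable
  have hprob1 := Measure.isProbabilityMeasure_map (μ := P) h1.aemeasurable
  have hprob2 := Measure.isProbabilityMeasure_map (μ := P) h2.aemeasurable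
  have hXY := (indepFun_iff_map_prod_eq_prod_map_map h1.aemeasurable h2.aemeasurable).1
    hN.relay_indep_interferer
  have hF := hN.fading_indep.map_fun_eq_infinitePi_map hN.fading_measurable
  simp_rw [hN.fading_law] at hF
  have hall := (indepFun_iff_map_prod_eq_prod_map_map h3.aemeasurable
    (h1.prodMk h2).aemeasurable).1 hN.fading_indep_positions
  rw [hXY, hF] at hall
  have hsplit := infinitePi_map_prodMk_of_disjoint ν
    (f := fun a : ℕ × ℕ × Option ℕ => (a.1, Transmitter.interferer a.2.1, receiverOf a.2.2))
    (g := fun a : ℕ × Option ℕ × Option ℕ => (a.1, transmitterOf a.2.1, receiverOf a.2.2))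
    (fun a b h => by
      simp only [Prod.mk.injEq, Transmitter.interferer.injEq] at h
      exact Prod.ext h.1 (Prod.ext h.2.1 (receiverOf_injective h.2.2)))
    (fun a b h => by
      simp only [Prod.mk.injEq] at h
      exact Prod.ext h.1 (Prod.ext (transmitterOf_injective h.2.1) (receiverOf_injective h.2.2)))
    (fun a b h => by
      rcases a with ⟨_, _, _⟩
      rcases b with ⟨_, _ | _, _⟩ <;> simp [transmitterOf] at h)
  set ρ := P.map fun ω i => N.relay i ω
  set Q := P.map fun ω t k => N.interferer t k ω
  have hrw : N.configuration =
      (fun p : (((ℕ × ℕ × Option ℕ) → H) × ((ℕ × Option ℕ × Option ℕ) → H)) ×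
          ((ℕ → Plane) × (ℕ → ℕ → Plane)) => ((p.2.1, p.2.2, p.1.1), p.1.2)) ∘
        (Prod.map (fun h => (fun a => h (a.1, Transmitter.interferer a.2.1, receiverOf a.2.2),
          fun a => h (a.1, transmitterOf a.2.1, receiverOf a.2.2))) id) ∘
        fun ω => (fun a => N.fading a ω, (fun i => N.relay i ω, fun t k => N.interferer t k ω)) := by
    rfl
  have hobj := h3.prodMk (h1.prodMk h2)
  have hpick : Measurable fun h : ℕ × Transmitter × Receiver → H =>
      ((fun a : ℕ × ℕ × Option ℕ => h (a.1, Transmitter.interferer a.2.1, receiverOf a.2.2)),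
        fun a : ℕ × Option ℕ × Option ℕ => h (a.1, transmitterOf a.2.1, receiverOf a.2.2)) := by
    fun_prop
  rw [hrw, ← Measure.map_map (by fun_prop) ((hpick.prodMap measurable_id).comp hobj),
    ← Measure.map_map (hpick.prodMap measurable_id) hobj, hall,
    ← Measure.map_prod_map _ _ (by fun_prop) measurable_id, hsplit, Measure.map_id]
  symm
  unfold configurationLaw environmentLaw
  set W := Measure.infinitePi fun _ : ℕ × ℕ × Option ℕ => ν
  set L := Measure.infinitePi fun _ : ℕ × Option ℕ × Option ℕ => ν
  have e1 : (ρ.prod (Q.prod W)).prod L =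
      (((ρ.prod Q).prod W).prod L).map
        (Prod.map MeasurableEquiv.prodAssoc id) := by
    rw [← Measure.map_prod_map _ _ (by fun_prop) measurable_id, Measure.map_id,
      (measurePreserving_prodAssoc ρ Q W).map_eq]
  have e2 : ((W.prod L).prod (ρ.prod Q)) =
      (((ρ.prod Q).prod W).prod L).map (fun p => ((p.1.2, p.2), p.1.1)) := by
    rw [← Measure.prod_swap, ← (measurePreserving_prodAssoc (ρ.prod Q) W L).map_eq,
      Measure.map_map (by fun_prop) (by fun_prop)]
    rfl
  rw [e1, e2, Measure.map_map (by fun_prop) (by fun_prop)]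
  rfl

end RelayNetwork

/-! ### Enumerations of the points of a Poisson process in a window -/

/-- The number of enumerations of `I` by `Fin k` with prescribed colours. -/
theorem encard_colored_enumerations {Q : Type*} [Fintype Q] [DecidableEq Q] {k : ℕ} (I : Set ℕ)
    (c : ℕ → Q) (a : Fin k → Q)
    [Decidable (∀ q, {i | i ∈ I ∧ c i = q}.encard = ({j | a j = q}.ncard : ℕ))] :
    {e : Fin k ↪ ℕ | Set.range e = I ∧ ∀ j, c (e j) = a j}.encard =
      if ∀ q, {i | i ∈ I ∧ c i = q}.encard = ({j | a j = q}.ncard : ℕ) then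
        ((∏ q, ({j | a j = q}.ncard).factorial : ℕ) : ℕ∞) else 0 := by
  by_cases hne : ∃ e₀ : Fin k ↪ ℕ, Set.range e₀ = I ∧ ∀ j, c (e₀ j) = a j
  · obtain ⟨e₀, hr, hc⟩ := hne
    rw [if_pos]
    -- Two enumerations of `I` with the same colours differ by a permutation of `Fin k` that fixes
    -- `a`. The stabilizer of `a` has order the product of the factorials of the fibre sizes.
    · have himg : {e : Fin k ↪ ℕ | Set.range e = I ∧ ∀ j, c (e j) = a j} =
          (fun g : Equiv.Perm (Fin k) => g.toEmbedding.trans e₀) '' {g | a ∘ g = a} := by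
        ext e
        constructor
        · rintro ⟨h1, h2⟩
          let g : Equiv.Perm (Fin k) := (Equiv.ofInjective e e.injective).trans
            ((Equiv.setCongr (h1.trans hr.symm)).trans (Equiv.ofInjective e₀ e₀.injective).symm)
          have hg : ∀ j, e₀ (g j) = e j := fun j => by
            simp [g, Equiv.apply_ofInjective_symm e₀.injective]
          refine ⟨g, ?_, ?_⟩
          · funext j
            simp only [Function.comp_apply]
            rw [← hc, hg, h2]
          · ext j
            simp [hg]
        · rintro ⟨g, hg, rfl⟩
          refine ⟨?_, fun j => ?_⟩
          · rw [← hr]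
            simp [Function.Embedding.trans, Set.range_comp]
          · have := congrFun hg j
            simpa [hc] using this
      have hinj : Function.Injective
          (fun g : Equiv.Perm (Fin k) => g.toEmbedding.trans e₀) := by
        intro g g' h
        ext j
        have := DFunLike.congr_fun h j
        simp only [Function.Embedding.trans_apply, Equiv.toEmbedding_apply] at this
        exact congrArg Fin.val (e₀.injective this)
      rw [himg, hinj.encard_image, ← DomMulAct.stabilizer_ncard a,
        (Set.toFinite {g : Equiv.Perm (Fin k) | a ∘ g = a}).cast_ncard_eq]
    · intro q
      have : {i | i ∈ I ∧ c i = q} = e₀ '' {j | a j = q} := by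
        ext i
        rw [← hr]
        constructor
        · rintro ⟨⟨j, rfl⟩, h⟩
          exact ⟨j, by simpa [hc] using h, rfl⟩
        · rintro ⟨j, h, rfl⟩
          exact ⟨⟨j, rfl⟩, by simpa [hc] using h⟩
      rw [this, e₀.injective.encard_image, (Set.toFinite _).cast_ncard_eq]
  · rw [if_neg, Set.encard_eq_zero]
    · exact Set.eq_empty_of_forall_notMem fun e he => hne ⟨e, he⟩
    · intro hcard
      apply hne
      -- When the colour classes have the right sizes, bijections between the classes glue to an
      -- enumeration.
      have hq : ∀ q, Nonempty ({j // a j = q} ≃ {i : I // c i = q}) := by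
        intro q
        have hfin : {i | i ∈ I ∧ c i = q}.Finite := Set.finite_of_encard_eq_coe (hcard q)
        have e1 : {i : I // c i = q} ≃ {i | i ∈ I ∧ c i = q} :=
          Equiv.subtypeSubtypeEquivSubtypeInter (fun i => i ∈ I) (fun i => c i = q)
        have : Finite {i | i ∈ I ∧ c i = q} := hfin
        have h2 : Nat.card {j | a j = q} = Nat.card {i | i ∈ I ∧ c i = q} := by
          have := hcard q
          rw [← hfin.cast_ncard_eq] at this
          rw [Nat.card_coe_set_eq, Nat.card_coe_set_eq]
          exact_mod_cast this.symm
        exact ⟨(Finite.card_eq.1 h2).some.trans e1.symm⟩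
      let f := fun q => (hq q).some
      let E : Fin k ≃ I := (Equiv.sigmaFiberEquiv a).symm.trans
        ((Equiv.sigmaCongrRight f).trans (Equiv.sigmaFiberEquiv fun i : I => c i))
      refine ⟨E.toEmbedding.trans (Function.Embedding.subtype _), ?_, fun j => ?_⟩
      · ext i
        constructor
        · rintro ⟨j, rfl⟩
          exact (E j).2
        · intro hi
          exact ⟨E.symm ⟨i, hi⟩, by simp⟩
      · exact (f (a j) ⟨j, rfl⟩).2

instance countable_fin_embedding (k : ℕ) : Countable (Fin k ↪ ℕ) :=
  DFunLike.coe_injective.countable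

/-- The configurations of positions whose points in `B` are exactly those enumerated by `e`. -/
def enumerates (B : Set Plane) {k : ℕ} (e : Fin k ↪ ℕ) : Set (ℕ → Plane) :=
  {x | Set.range e = {i | x i ∈ B}}

theorem measurableSet_enumerates {B : Set Plane} (hB : MeasurableSet B) {k : ℕ} (e : Fin k ↪ ℕ) :
    MeasurableSet (enumerates B e) := by
  have : enumerates B e = ⋂ i : ℕ, {x | i ∈ Set.range e ↔ x i ∈ B} := by
    ext x
    simp [enumerates, Set.ext_iff]
  rw [this]
  refine MeasurableSet.iInter fun i => ?_
  have hi : MeasurableSet {x : ℕ → Plane | x i ∈ B} := measurable_pi_apply i hB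
  by_cases h : i ∈ Set.range e
  · simpa only [h, true_iff] using hi
  · simp only [h, false_iff]
    exact hi.compl

/-! ### Poisson points in a window as independent uniform points -/

section Poisson

variable {Ω : Type*} [MeasurableSpace Ω] {P : Measure Ω}
  {X : ℕ → Ω → Plane} {c : ℝ} {B : Set Plane} {u : Measure Plane}

/-- The joint law of the numbers of points of each colour in the window `B`. -/
theorem IsHPPP.measure_pointCount_color (hX : IsHPPP P X c) (hc : 0 < c)
    (hB : MeasurableSet B) (hBfin : volume B ≠ ∞)
    (hu : ∀ D, MeasurableSet D → c * volume.real (B ∩ D) = c * volume.real B * u.real D)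
    {Q : Type*} [Fintype Q] [MeasurableSpace Q] [DiscreteMeasurableSpace Q]
    {χ : Plane → Q} (hχ : Measurable χ) (n : Q → ℕ) :
    P {ω | ∀ q, pointCount X (B ∩ χ ⁻¹' {q}) ω = n q} =
      ENNReal.ofReal (∏ q, (Real.exp (-(c * volume.real B * u.real (χ ⁻¹' {q}))) *
        (c * volume.real B * u.real (χ ⁻¹' {q})) ^ n q / (n q).factorial)) := by
  classical
  have hD : ∀ q, MeasurableSet (χ ⁻¹' {q}) := fun q => hχ (MeasurableSet.of_discrete)
  have hBD : ∀ q, MeasurableSet (B ∩ χ ⁻¹' {q}) := fun q => hB.inter (hD q)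
  have hfin : ∀ q, volume (B ∩ χ ⁻¹' {q}) ≠ ∞ := fun q =>
    ne_top_of_le_ne_top hBfin (measure_mono Set.inter_subset_left)
  let σ := (Fintype.equivFin Q).symm
  have hind := hX.count_indep (Fintype.card Q) (fun j => B ∩ χ ⁻¹' {σ j}) (fun j => hBD _)
    (fun j => hfin _) (fun j k hjk => by
      rw [Set.disjoint_left]
      rintro x ⟨_, h1⟩ ⟨_, h2⟩
      exact hjk (σ.injective (by rw [← Set.mem_singleton_iff.1 h1, ← Set.mem_singleton_iff.1 h2])))
  have h1 := hind.measure_inter_preimage_eq_mul Finset.univ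
    (sets := fun j => {((n (σ j) : ℕ) : ℕ∞)}) (fun j _ => MeasurableSet.of_discrete)
  have hset : {ω | ∀ q, pointCount X (B ∩ χ ⁻¹' {q}) ω = n q} =
      ⋂ j ∈ Finset.univ, (pointCount X (B ∩ χ ⁻¹' {σ j})) ⁻¹' {((n (σ j) : ℕ) : ℕ∞)} := by
    ext ω
    simp [σ.forall_congr_right (q := fun q => pointCount X (B ∩ χ ⁻¹' {q}) ω = n q)]
  rw [hset, h1, ENNReal.ofReal_prod_of_nonneg (fun q _ => by positivity),
    ← σ.prod_comp (g := fun q => ENNReal.ofReal _)]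
  refine Finset.prod_congr rfl fun j _ => ?_
  have := hX.count_law _ (hBD (σ j)) (hfin (σ j)) (n (σ j))
  rw [hu _ (hD _), poissonMeasure_singleton, Real.coe_toNNReal _ (by positivity)] at this
  exact this

theorem encard_eq_tsum_indicator {α ι : Type*} (S : ι → Set α) (x : α) :
    (({i | x ∈ S i}.encard : ℕ∞) : ℝ≥0∞) = ∑' i, (S i).indicator 1 x := by
  rw [← ENNReal.tsum_set_one, tsum_subtype {i | x ∈ S i} fun _ => (1 : ℝ≥0∞)]
  rfl

theorem tsum_measure_eq_lintegral_encard {α ι : Type*} [MeasurableSpace α] [Countable ι]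
    (μ : Measure α) {S : ι → Set α} (hS : ∀ i, MeasurableSet (S i)) :
    ∑' i, μ (S i) = ∫⁻ x, (({i | x ∈ S i}.encard : ℕ∞) : ℝ≥0∞) ∂μ := by
  simp_rw [encard_eq_tsum_indicator]
  rw [lintegral_tsum fun i => (measurable_one.indicator (hS i)).aemeasurable]
  simp_rw [lintegral_indicator_one (hS _)]

/-- The enumerations by `Fin k` of the points in the window `B`, when there are `k` of them, have
total law a multiple of that of `k` independent uniform points. -/
theorem IsHPPP.sum_map_restrict_enumerates [IsProbabilityMeasure u] (hX : IsHPPP P X c) (hc : 0 < c)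
    (hB : MeasurableSet B) (hBfin : volume B ≠ ∞)
    (hu : ∀ D, MeasurableSet D → c * volume.real (B ∩ D) = c * volume.real B * u.real D) (k : ℕ) :
    Measure.sum (fun e : Fin k ↪ ℕ => ((P.map fun ω i => X i ω).restrict (enumerates B e)).map
        fun x j => x (e j)) =
      ENNReal.ofReal (Real.exp (-(c * volume.real B)) * (c * volume.real B) ^ k) •
        Measure.infinitePi fun _ : Fin k => u := by
  classical
  have hXm : Measurable fun ω i => X i ω := measurable_pi_iff.2 hX.measurable
  set M := Measure.sum (fun e : Fin k ↪ ℕ =>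
    ((P.map fun ω i => X i ω).restrict (enumerates B e)).map fun x j => x (e j)) with hM
  set r := c * volume.real B with hr
  have hr0 : 0 ≤ r := by positivity
  -- The left side is the expected number of enumerations coloured by `a`. If colour `q` occurs `n
  -- q` times in `a`, there are `∏ (n q)!` of them when the colour counts match and none otherwise.
  -- These factorials cancel those of the independent Poisson counts, leaving `exp (-r) * r ^ k`
  -- times the product of the `u`-masses of the colours.
  have hcolor : ∀ (Q : Type) [Fintype Q] [MeasurableSpace Q] [DiscreteMeasurableSpace Q]
      (χ : Plane → Q), Measurable χ → ∀ a : Fin k → Q,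
      M {z | ∀ j, χ (z j) = a j} = (ENNReal.ofReal (Real.exp (-r) * r ^ k) •
        Measure.infinitePi fun _ : Fin k => u) {z | ∀ j, χ (z j) = a j} := by
    intro Q _ _ _ χ hχ a
    have hA : MeasurableSet {z : Fin k → Plane | ∀ j, χ (z j) = a j} := by
      rw [Set.ofPred_forall]
      exact MeasurableSet.iInter fun j =>
        (hχ.comp (measurable_pi_apply j)) (MeasurableSet.of_discrete (s := {a j}))
    have hS : ∀ e : Fin k ↪ ℕ, MeasurableSet
        {ω | Set.range e = {i | X i ω ∈ B} ∧ ∀ j, χ (X (e j) ω) = a j} := fun e => by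
      have h1 := hXm (measurableSet_enumerates hB e)
      have h2 := (show Measurable fun (x : ℕ → Plane) j => x (e j) by fun_prop).comp hXm hA
      exact h1.inter h2
    have hMA : M {z | ∀ j, χ (z j) = a j} = ∑' e : Fin k ↪ ℕ,
        P {ω | Set.range e = {i | X i ω ∈ B} ∧ ∀ j, χ (X (e j) ω) = a j} := by
      rw [hM, Measure.sum_apply _ hA]
      refine tsum_congr fun e => ?_
      have hpull : Measurable fun (x : ℕ → Plane) j => x (e j) := by fun_prop
      rw [Measure.map_apply hpull hA, Measure.restrict_apply (hpull hA),
        Measure.map_apply hXm ((hpull hA).inter (measurableSet_enumerates hB e))]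
      congr 1
      ext ω
      simp [enumerates, and_comm]
    rw [hMA, tsum_measure_eq_lintegral_encard P hS]
    have hcount : ∀ ω, {e : Fin k ↪ ℕ | ω ∈
        {ω | Set.range e = {i | X i ω ∈ B} ∧ ∀ j, χ (X (e j) ω) = a j}}.encard =
        if ∀ q, pointCount X (B ∩ χ ⁻¹' {q}) ω = ({j | a j = q}.ncard : ℕ) then
          ((∏ q, ({j | a j = q}.ncard).factorial : ℕ) : ℕ∞) else 0 := fun ω =>
      encard_colored_enumerations {i | X i ω ∈ B} (fun i => χ (X i ω)) a
    -- Matching counts mean that some coloured enumeration exists, so the event is a countable union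
    -- of measurable ones.
    have hmeas : MeasurableSet {ω | ∀ q, pointCount X (B ∩ χ ⁻¹' {q}) ω =
        ({j | a j = q}.ncard : ℕ)} := by
      have : {ω | ∀ q, pointCount X (B ∩ χ ⁻¹' {q}) ω = ({j | a j = q}.ncard : ℕ)} =
          ⋃ e : Fin k ↪ ℕ, {ω | Set.range e = {i | X i ω ∈ B} ∧ ∀ j, χ (X (e j) ω) = a j} := by
        ext ω
        rw [Set.mem_iUnion, Set.mem_ofPred_eq]
        have h := hcount ω
        constructor
        · intro hω
          rw [if_pos hω] at h
          refine Set.encard_ne_zero.1 (h.trans_ne ?_)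
          exact_mod_cast Finset.prod_ne_zero_iff.2 fun q _ => Nat.factorial_ne_zero _
        · intro hω
          by_contra hn
          rw [if_neg hn] at h
          exact Set.encard_ne_zero.2 hω h
      rw [this]
      exact MeasurableSet.iUnion hS
    have hint : (fun ω => (({e : Fin k ↪ ℕ | ω ∈
        {ω | Set.range e = {i | X i ω ∈ B} ∧ ∀ j, χ (X (e j) ω) = a j}}.encard : ℕ∞) : ℝ≥0∞)) =
        {ω | ∀ q, pointCount X (B ∩ χ ⁻¹' {q}) ω = ({j | a j = q}.ncard : ℕ)}.indicator
          fun _ => ((∏ q, ({j | a j = q}.ncard).factorial : ℕ) : ℝ≥0∞) := by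
      funext ω
      rw [hcount ω, Set.indicator_apply]
      split_ifs with h1 h2 h2
      · exact ENat.toENNReal_coe _
      · exact absurd h1 h2
      · exact absurd h2 h1
      · simp
    rw [hint, lintegral_indicator_const hmeas,
      hX.measure_pointCount_color hc hB hBfin hu hχ]
    have hbox : {z : Fin k → Plane | ∀ j, χ (z j) = a j} =
        Set.pi (Finset.univ : Finset (Fin k)) fun j => χ ⁻¹' {a j} := by
      ext z; simp [Set.mem_pi]
    rw [Measure.smul_apply, hbox, Measure.infinitePi_pi _ fun j _ => hχ MeasurableSet.of_discrete,
      smul_eq_mul]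
    have hur : ∀ q, u (χ ⁻¹' {q}) = ENNReal.ofReal (u.real (χ ⁻¹' {q})) := fun q => by
      rw [ofReal_measureReal]
    simp_rw [hur]
    rw [← ENNReal.ofReal_prod_of_nonneg (fun _ _ => measureReal_nonneg),
      ← ENNReal.ofReal_mul (by positivity), ← ENNReal.ofReal_natCast,
      ← ENNReal.ofReal_mul (by positivity)]
    congr 1
    simp_rw [mul_div_assoc, Finset.prod_mul_distrib, Finset.prod_div_distrib]
    have hsum : ∏ q, Real.exp (-(r * u.real (χ ⁻¹' {q}))) = Real.exp (-r) := by
      rw [← Real.exp_sum, Finset.sum_neg_distrib, ← Finset.mul_sum]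
      have : ∑ q, u.real (χ ⁻¹' {q}) = 1 := by
        have := sum_measureReal_preimage_singleton (μ := u) (f := χ) Finset.univ
          (fun q _ => hχ MeasurableSet.of_discrete)
        simpa using this
      rw [this, mul_one]
    have hpow : ∏ q, (r * u.real (χ ⁻¹' {q})) ^ {j | a j = q}.ncard =
        r ^ k * ∏ j, u.real (χ ⁻¹' {a j}) := by
      have h1 : ∀ q, {j | a j = q}.ncard = (Finset.univ.filter fun j => a j = q).card := fun q => by
        rw [← Set.ncard_coe_finset]; simp
      simp_rw [h1]
      simp_rw [← Finset.prod_const]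
      rw [Finset.prod_fiberwise' Finset.univ a fun q => r * u.real (χ ⁻¹' {q})]
      simp [Finset.prod_mul_distrib]
    have hfact : (∏ q, (({j | a j = q}.ncard).factorial : ℝ)) ≠ 0 := by positivity
    rw [hsum, hpow]
    push_cast
    field_simp
  have : IsFiniteMeasure (ENNReal.ofReal (Real.exp (-r) * r ^ k) •
      Measure.infinitePi fun _ : Fin k => u) := Measure.smul_finite _ ENNReal.ofReal_ne_top
  refine (ext_of_generate_finite _ generateFrom_pi.symm isPiSystem_pi ?_ ?_).symm
  · rintro _ ⟨A, hA, rfl⟩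
    have hAm : ∀ j, MeasurableSet (A j) := fun j => hA j trivial
    -- Colour a point by the set of indices `j` with `x ∈ A j`. The box is then a finite union of
    -- sets with prescribed colours, to which `hcolor` applies.
    let χ : Plane → (Fin k → Bool) := fun x j => decide (x ∈ A j)
    have hχ : Measurable χ := measurable_pi_iff.2 fun j => measurable_to_bool <| by
      convert hAm j using 1
      ext x
      simp [χ]
    have hΦ : Measurable fun (z : Fin k → Plane) j => χ (z j) :=
      measurable_pi_iff.2 fun j => hχ.comp (measurable_pi_apply j)
    have hmap : (ENNReal.ofReal (Real.exp (-r) * r ^ k) •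
        Measure.infinitePi fun _ : Fin k => u).map (fun z j => χ (z j)) =
        M.map fun z j => χ (z j) := by
      refine Measure.ext_of_singleton fun a => ?_
      rw [Measure.map_apply hΦ MeasurableSet.of_discrete,
        Measure.map_apply hΦ MeasurableSet.of_discrete]
      have : (fun (z : Fin k → Plane) j => χ (z j)) ⁻¹' {a} = {z | ∀ j, χ (z j) = a j} := by
        ext z
        simp [funext_iff]
      rw [this, hcolor _ χ hχ a]
    have hT : Set.pi Set.univ A = (fun (z : Fin k → Plane) j => χ (z j)) ⁻¹'
        {a | ∀ j, a j j = true} := by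
      ext z
      simp [χ, Set.mem_pi]
    rw [hT, ← Measure.map_apply hΦ MeasurableSet.of_discrete, hmap,
      Measure.map_apply hΦ MeasurableSet.of_discrete]
  -- The total masses agree by the case of a single colour.
  · have := hcolor Unit (fun _ => ()) measurable_const fun _ => ()
    simpa using this.symm

end Poisson

/-! ### Reduction to independent uniform relays -/

theorem encard_enumerations (k : ℕ) (I : Set ℕ) [Decidable (I.encard = k)] :
    {e : Fin k ↪ ℕ | Set.range e = I}.encard =
      if I.encard = k then ((k.factorial : ℕ) : ℕ∞) else 0 := by
  classical
  have := encard_colored_enumerations (k := k) I (fun _ => ()) fun _ => ()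
  simp only [implies_true, and_true, forall_const, Set.ofPred_mem_eq, Set.ofPred_true,
    Set.ncard_univ, Nat.card_eq_fintype_card, Fintype.card_fin, Finset.univ_unique,
    Finset.prod_const, Finset.card_singleton, pow_one] at this
  rw [this]

/-- The Poisson masses of the finite counts already add up to one. Measurability comes from the
countably many possible enumerations. -/
theorem IsHPPP.ae_finite {Ω : Type*} [MeasurableSpace Ω] {P : Measure Ω} [IsProbabilityMeasure P]
    {X : ℕ → Ω → Plane} {c : ℝ} {B : Set Plane} (hX : IsHPPP P X c) (hB : MeasurableSet B)
    (hBfin : volume B ≠ ∞) :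
    ∀ᵐ x ∂(P.map fun ω i => X i ω), {i | x i ∈ B}.Finite := by
  classical
  have hXm : Measurable fun ω i => X i ω := measurable_pi_iff.2 hX.measurable
  have hS : MeasurableSet {x : ℕ → Plane | {i | x i ∈ B}.Finite} := by
    have : {x : ℕ → Plane | {i | x i ∈ B}.Finite} = ⋃ (k : ℕ) (e : Fin k ↪ ℕ), enumerates B e := by
      ext x
      simp only [Set.mem_ofPred_eq, Set.mem_iUnion]
      constructor
      · intro hx
        refine ⟨_, (Set.encard_ne_zero (s := {e : Fin {i | x i ∈ B}.ncard ↪ ℕ |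
          Set.range e = {i | x i ∈ B}})).1 ?_⟩
        rw [encard_enumerations, if_pos hx.cast_ncard_eq.symm]
        exact_mod_cast Nat.factorial_ne_zero _
      · rintro ⟨k, e, he⟩
        rw [← show Set.range e = {i | x i ∈ B} from he]
        exact Set.finite_range e
    rw [this]
    exact MeasurableSet.iUnion fun k => MeasurableSet.iUnion fun e => measurableSet_enumerates hB e
  refine (ae_map_iff hXm.aemeasurable hS).2 ?_
  have hm : ∀ n : ℕ, MeasurableSet {ω | pointCount X B ω = n} := by
    intro n
    have : {ω | pointCount X B ω = n} =
        ⋃ e : Fin n ↪ ℕ, (fun ω i => X i ω) ⁻¹' enumerates B e := by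
      ext ω
      have h := encard_enumerations n {i | X i ω ∈ B}
      rw [Set.mem_iUnion, Set.mem_ofPred_eq, pointCount]
      constructor
      · intro hω
        rw [if_pos hω] at h
        refine Set.encard_ne_zero.1 (h.trans_ne ?_)
        exact_mod_cast Nat.factorial_ne_zero _
      · intro hω
        by_contra hn
        rw [if_neg hn] at h
        exact Set.encard_ne_zero.2 hω h
    rw [this]
    exact MeasurableSet.iUnion fun e => hXm (measurableSet_enumerates hB e)
  have hdisj : Pairwise (Function.onFun Disjoint fun n : ℕ => {ω | pointCount X B ω = n}) := by
    intro n n' hnn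
    rw [Function.onFun, Set.disjoint_left]
    intro ω h1 h2
    exact hnn (by exact_mod_cast h1.symm.trans h2)
  have hfull : P (⋃ n : ℕ, {ω | pointCount X B ω = n}) = 1 := by
    rw [measure_iUnion hdisj hm]
    simp_rw [hX.count_law B hB hBfin]
    rw [← measure_univ (μ := poissonMeasure (Real.toNNReal (c * volume.real B))),
      ← Set.iUnion_of_singleton ℕ,
      measure_iUnion (fun i j hij => by simpa using hij) fun _ => MeasurableSet.of_discrete]
  have hae : ∀ᵐ ω ∂P, ω ∈ ⋃ n : ℕ, {ω | pointCount X B ω = n} :=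
    (prob_compl_eq_zero_iff (MeasurableSet.iUnion hm)).2 hfull
  filter_upwards [hae] with ω hω
  obtain ⟨n, hn⟩ := Set.mem_iUnion.1 hω
  exact Set.finite_of_encard_eq_coe hn

/-! ### Conditioning on the number of relays in the window -/

section

variable {H ι : Type*} [MeasurableSpace H]

/-- With the positions outermost, their law enters linearly and can be summed over enumerations. -/
theorem lintegral_configurationLaw (ρ : Measure (ι → Plane)) (Q : Measure (ℕ → ℕ → Plane))
    [IsProbabilityMeasure Q] (ν : Measure H) [IsProbabilityMeasure ν]
    {g : Configuration H ι → ℝ≥0∞} (hg : Measurable g) :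
    ∫⁻ c, g c ∂(configurationLaw ρ Q ν) =
      ∫⁻ x, ∫⁻ y, ∫⁻ l, g ((x, y), l) ∂(Measure.infinitePi fun _ => ν)
        ∂(Q.prod (Measure.infinitePi fun _ => ν)) ∂ρ := by
  unfold configurationLaw environmentLaw
  rw [lintegral_prod _ hg.aemeasurable, lintegral_prod _ hg.lintegral_prod_right'.aemeasurable]

theorem restrict_configurationLaw (ρ : Measure (ι → Plane)) [IsProbabilityMeasure ρ]
    (Q : Measure (ℕ → ℕ → Plane)) [IsProbabilityMeasure Q] (ν : Measure H) [IsProbabilityMeasure ν]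
    (E : Set (ι → Plane)) :
    (configurationLaw ρ Q ν).restrict {c | c.1.1 ∈ E} = configurationLaw (ρ.restrict E) Q ν := by
  unfold configurationLaw environmentLaw
  have : {c : Configuration H ι | c.1.1 ∈ E} = (E ×ˢ Set.univ) ×ˢ Set.univ := by
    ext c; simp
  rw [this, ← Measure.prod_restrict, ← Measure.prod_restrict, Measure.restrict_univ,
    Measure.restrict_univ]

/-- A functional of a configuration with Poisson positions, depending only on the relays in the
window `B`, is computed by conditioning on the number of these relays. -/
theorem IsHPPP.lintegral_configurationLaw_eq_tsum {Ω : Type*} [MeasurableSpace Ω] {P : Measure Ω}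
    [IsProbabilityMeasure P] {X : ℕ → Ω → Plane} {c : ℝ} {B : Set Plane} {u : Measure Plane}
    [IsProbabilityMeasure u] (hX : IsHPPP P X c) (hc : 0 < c)
    (hB : MeasurableSet B) (hBfin : volume B ≠ ∞)
    (hu : ∀ D, MeasurableSet D → c * volume.real (B ∩ D) = c * volume.real B * u.real D)
    (Q : Measure (ℕ → ℕ → Plane)) [IsProbabilityMeasure Q] (ν : Measure H) [IsProbabilityMeasure ν]
    {f : Configuration H ℕ → ℝ≥0∞} {g : ∀ k : ℕ, Configuration H (Fin k) → ℝ≥0∞}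
    (hg : ∀ k, Measurable (g k))
    (hfg : ∀ (w : Configuration H ℕ) (k : ℕ) (e : Fin k ↪ ℕ),
      Set.range e = {i | w.1.1 i ∈ B} → f w = g k (w.pull e)) :
    ∫⁻ w, f w ∂(configurationLaw (P.map fun ω i => X i ω) Q ν) =
      ∑' k : ℕ, poissonMeasure (Real.toNNReal (c * volume.real B)) {k} *
        ∫⁻ w, g k w ∂(configurationLaw (Measure.infinitePi fun _ => u) Q ν) := by
  classical
  have hXm : Measurable fun ω i => X i ω := measurable_pi_iff.2 hX.measurable
  set ρ := P.map fun ω i => X i ω with hρ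
  have : IsProbabilityMeasure ρ := Measure.isProbabilityMeasure_map hXm.aemeasurable
  have hpos : Measurable fun w : Configuration H ℕ => w.1.1 := by fun_prop
  have hposmap : (configurationLaw ρ Q ν).map (fun w => w.1.1) = ρ := by
    unfold configurationLaw environmentLaw
    have : (fun w : Configuration H ℕ => w.1.1) = Prod.fst ∘ Prod.fst := rfl
    rw [this, ← Measure.map_map (by fun_prop) (by fun_prop), Measure.map_fst_prod,
      measure_univ, one_smul, Measure.map_fst_prod, measure_univ, one_smul]
  have hfin : ∀ᵐ w ∂(configurationLaw ρ Q ν), {i | w.1.1 i ∈ B}.Finite := by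
    refine ae_of_ae_map (p := fun x => {i | x i ∈ B}.Finite) hpos.aemeasurable ?_
    rw [hposmap]
    exact hX.ae_finite hB hBfin
  have hE : ∀ {k : ℕ} (e : Fin k ↪ ℕ),
      MeasurableSet {w : Configuration H ℕ | w.1.1 ∈ enumerates B e} := fun e =>
    hpos (measurableSet_enumerates hB e)
  -- If the window contains exactly `k` points, they have `k!` enumerations, and `g k` takes the
  -- value `f w` along each; all other values of `k` contribute zero.
  have hexp : ∀ᵐ w ∂(configurationLaw ρ Q ν), f w = ∑' k : ℕ, (k.factorial : ℝ≥0∞)⁻¹ *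
      ∑' e : Fin k ↪ ℕ, {w : Configuration H ℕ | w.1.1 ∈ enumerates B e}.indicator
        (fun w => g k (w.pull e)) w := by
    filter_upwards [hfin] with w hw
    have hterm : ∀ k : ℕ, (k.factorial : ℝ≥0∞)⁻¹ *
        ∑' e : Fin k ↪ ℕ, {w : Configuration H ℕ | w.1.1 ∈ enumerates B e}.indicator
          (fun w => g k (w.pull e)) w = if k = {i | w.1.1 i ∈ B}.ncard then f w else 0 := by
      intro k
      have h1 : ∀ e : Fin k ↪ ℕ, {w : Configuration H ℕ | w.1.1 ∈ enumerates B e}.indicator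
          (fun w => g k (w.pull e)) w =
          {e : Fin k ↪ ℕ | Set.range e = {i | w.1.1 i ∈ B}}.indicator (fun _ => f w) e := by
        intro e
        simp only [Set.indicator_apply, Set.mem_ofPred_eq, enumerates]
        split_ifs with h
        · exact (hfg w k e h).symm
        · rfl
      simp_rw [h1]
      rw [← tsum_subtype, ENNReal.tsum_set_const, encard_enumerations]
      have h2 : {i | w.1.1 i ∈ B}.encard = k ↔ k = {i | w.1.1 i ∈ B}.ncard := by
        rw [← hw.cast_ncard_eq]
        exact_mod_cast eq_comm
      simp only [h2]
      split_ifs with h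
      · rw [ENat.toENNReal_coe, ← mul_assoc, ENNReal.inv_mul_cancel, one_mul]
        · exact_mod_cast Nat.factorial_ne_zero _
        · exact ENNReal.natCast_ne_top _
      · simp
    simp_rw [hterm]
    rw [tsum_ite_eq]
  have hind : ∀ (k : ℕ) (e : Fin k ↪ ℕ), Measurable fun w : Configuration H ℕ =>
      {w : Configuration H ℕ | w.1.1 ∈ enumerates B e}.indicator (fun w => g k (w.pull e)) w :=
    fun k e => ((hg k).comp (Configuration.measurable_pull _)).indicator (hE e)
  rw [lintegral_congr_ae hexp,
    lintegral_tsum fun k => ((Measurable.tsum (hind k)).const_mul _).aemeasurable]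
  refine tsum_congr fun k => ?_
  rw [lintegral_const_mul _ (Measurable.tsum (hind k)),
    lintegral_tsum fun e => (hind k e).aemeasurable]
  -- Summed over `e`, the laws of the enumerated positions become a multiple of the uniform product;
  -- the factor `1 / k!` turns that multiple into the Poisson weight.
  have hsum := hX.sum_map_restrict_enumerates hc hB hBfin hu k
  have hstep : ∀ e : Fin k ↪ ℕ, ∫⁻ w, {w : Configuration H ℕ | w.1.1 ∈ enumerates B e}.indicator
        (fun w => g k (w.pull e)) w ∂(configurationLaw ρ Q ν) =
      ∫⁻ x, ∫⁻ y, ∫⁻ l, g k ((x, y), l) ∂(Measure.infinitePi fun _ => ν)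
        ∂(Q.prod (Measure.infinitePi fun _ => ν)) ∂((ρ.restrict (enumerates B e)).map
          fun x j => x (e j)) := by
    intro e
    rw [lintegral_indicator (hE e), restrict_configurationLaw,
      ← lintegral_configurationLaw _ Q ν (hg k), ← map_pull_configurationLaw e.injective,
      lintegral_map (hg k) (Configuration.measurable_pull _)]
  simp_rw [hstep]
  rw [← lintegral_sum_measure, hsum, lintegral_smul_measure,
    ← lintegral_configurationLaw _ Q ν (hg k), smul_eq_mul, ← mul_assoc, poissonMeasure_singleton,
    Real.coe_toNNReal _ (by positivity)]
  congr 1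
  rw [div_eq_inv_mul, ENNReal.ofReal_mul (p := (k.factorial : ℝ)⁻¹) (by positivity),
    ENNReal.ofReal_inv_of_pos (by positivity),
    ENNReal.ofReal_natCast]

end

/-! ### Positive correlation of decreasing events -/

/-- The Harris–FKG inequality for finitely many nonnegative antitone functions. -/
theorem prod_sum_le_sum_prod_of_antitone {α ρ : Type*} [DistribLattice α] [Fintype α]
    {w : α → ℝ} (hw₀ : 0 ≤ w) (hw₁ : ∑ a, w a = 1)
    (hw : ∀ a b, w a * w b ≤ w (a ⊓ b) * w (a ⊔ b)) (R : Finset ρ) (f : ρ → α → ℝ)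
    (hf₀ : ∀ r, 0 ≤ f r) (hf : ∀ r, Antitone (f r)) :
    ∏ r ∈ R, ∑ a, w a * f r a ≤ ∑ a, w a * ∏ r ∈ R, f r a := by
  classical
  induction R using Finset.induction_on with
  | empty => simp [hw₁]
  | insert r R hr ih =>
    have hnn : ∀ r, 0 ≤ ∑ a, w a * f r a := fun r =>
      Finset.sum_nonneg fun a _ => mul_nonneg (hw₀ a) (hf₀ r a)
    -- Antitone functions are monotone on the order dual. There meet and join trade places, whence
    -- the `mul_comm` in the lattice condition.
    have hfkg := fkg (α := αᵒᵈ) (μ := fun a => w (OrderDual.ofDual a))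
      (f := fun a => f r (OrderDual.ofDual a))
      (g := fun a => ∏ r ∈ R, f r (OrderDual.ofDual a)) (fun a => hw₀ _) (fun a => hf₀ _ _)
      (fun a => Finset.prod_nonneg fun r _ => hf₀ _ _) (fun a b hab => hf r hab)
      (fun a b hab => Finset.prod_le_prod (fun r _ => hf₀ _ _) fun r _ => hf r hab)
      (fun a b => (hw _ _).trans_eq (mul_comm _ _))
    rw [Finset.prod_insert hr]
    refine (mul_le_mul_of_nonneg_left ih (hnn r)).trans ?_
    have h1 : ∑ a : αᵒᵈ, w (OrderDual.ofDual a) = 1 := hw₁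
    rw [h1, one_mul] at hfkg
    simp_rw [Finset.prod_insert hr]
    exact hfkg

/-- The probability that a random set of independent elements, with `i` of probability `p i`,
equals `s`. -/
def bernoulliWeight {ι : Type*} [Fintype ι] [DecidableEq ι] (p : ι → ℝ) (s : Finset ι) : ℝ :=
  ∏ i, if i ∈ s then p i else 1 - p i

section BernoulliWeight

variable {ι : Type*} [Fintype ι] [DecidableEq ι] {p : ι → ℝ}

theorem bernoulliWeight_nonneg (h0 : ∀ i, 0 ≤ p i) (h1 : ∀ i, p i ≤ 1) (s : Finset ι) :
    0 ≤ bernoulliWeight p s :=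
  Finset.prod_nonneg fun i _ => by
    split_ifs
    · exact h0 i
    · linarith [h1 i]

/-- At each coordinate both sides have the same two factors up to order. This is the lattice
condition of FKG, with equality. -/
theorem bernoulliWeight_mul (s t : Finset ι) :
    bernoulliWeight p s * bernoulliWeight p t =
      bernoulliWeight p (s ⊓ t) * bernoulliWeight p (s ⊔ t) := by
  unfold bernoulliWeight
  rw [← Finset.prod_mul_distrib, ← Finset.prod_mul_distrib]
  refine Finset.prod_congr rfl fun i _ => ?_
  by_cases hs : i ∈ s <;> by_cases ht : i ∈ t <;> simp [hs, ht, mul_comm]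

/-- Expand the product of `p i + (1 - p i)`, with the second summand replaced by zero for `i ∈ B`:
exactly the terms of the sets that contain `B` survive. -/
theorem sum_bernoulliWeight_superset (B : Finset ι) :
    ∑ s, bernoulliWeight p s * (if B ⊆ s then 1 else 0) = ∏ i ∈ B, p i := by
  have h := Finset.prod_add p (fun i => if i ∈ B then 0 else 1 - p i) Finset.univ
  rw [Finset.powerset_univ] at h
  have hl : ∏ i, (p i + if i ∈ B then 0 else 1 - p i) = ∏ i ∈ B, p i := by
    rw [← Finset.prod_subset (Finset.subset_univ B)]
    · exact Finset.prod_congr rfl fun i hi => by simp [hi]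
    · intro i _ hi
      simp [hi]
  rw [← hl, h]
  refine Finset.sum_congr rfl fun s _ => ?_
  have hw : bernoulliWeight p s = (∏ i ∈ s, p i) * ∏ i ∈ Finset.univ \ s, (1 - p i) := by
    unfold bernoulliWeight
    rw [Finset.prod_ite]
    congr 1
    · exact Finset.prod_congr (by ext; simp) fun _ _ => rfl
    · exact Finset.prod_congr (by ext; simp) fun _ _ => rfl
  rw [hw, mul_assoc]
  congr 1
  split_ifs with hB
  · rw [mul_one]
    refine Finset.prod_congr rfl fun i hi => ?_
    rw [if_neg fun hiB => (Finset.mem_sdiff.1 hi).2 (hB hiB)]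
  · obtain ⟨i, hiB, his⟩ := Finset.not_subset.1 hB
    rw [mul_zero]
    exact (Finset.prod_eq_zero (i := i) (by simp [his]) (by simp [hiB])).symm

theorem sum_bernoulliWeight : ∑ s, bernoulliWeight p s = 1 := by
  simpa using sum_bernoulliWeight_superset (p := p) ∅

theorem bernoulliWeight_const (q : ℝ) (s : Finset ι) :
    bernoulliWeight (fun _ => q) s = q ^ s.card * (1 - q) ^ (Fintype.card ι - s.card) := by
  unfold bernoulliWeight
  rw [Finset.prod_ite, Finset.prod_const, Finset.prod_const]
  congr 2
  · congr 1; ext; simp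
  · rw [← Finset.card_compl]
    congr 1; ext; simp

end BernoulliWeight

open Classical in
/-- Under a product measure, the set of coordinates in prescribed sets is Bernoulli. -/
theorem integral_coordinates_mem {J H : Type*} [MeasurableSpace H] (ν : Measure H)
    [IsProbabilityMeasure ν] {G : J → Set H} (hG : ∀ i, MeasurableSet (G i)) (T : Finset J)
    (h : Finset T → ℝ) :
    ∫ l, h (Finset.univ.filter fun i : T => l i ∈ G i) ∂(Measure.infinitePi fun _ : J => ν) =
      ∑ s, bernoulliWeight (fun i : T => ν.real (G i)) s * h s := by
  set L := Measure.infinitePi fun _ : J => ν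
  let _ : MeasurableSpace (Finset T) := ⊤
  have : DiscreteMeasurableSpace (Finset T) := ⟨fun _ => trivial⟩
  let A : (J → H) → Finset T := fun l => Finset.univ.filter fun i : T => l i ∈ G i
  -- The event that `s` is exactly the set of good coordinates in `T` is the finite box with sides
  -- `D s`.
  let D : Finset T → J → Set H := fun s i =>
    if hi : i ∈ T then if ⟨i, hi⟩ ∈ s then G i else (G i)ᶜ else Set.univ
  have hD : ∀ s i, MeasurableSet (D s i) := by
    intro s i
    simp only [D]
    split_ifs
    · exact hG i
    · exact (hG i).compl
    · exact MeasurableSet.univ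
  have hpre : ∀ s, A ⁻¹' {s} = Set.pi T (D s) := by
    intro s
    ext l
    simp only [Set.mem_preimage, Set.mem_singleton_iff, Finset.ext_iff, A, Finset.mem_filter,
      Finset.mem_univ, true_and, Set.mem_pi, Finset.mem_coe]
    constructor
    · intro hl i hi
      have := hl ⟨i, hi⟩
      simp only [D, hi, dite_true]
      split_ifs with hs
      · exact this.2 hs
      · exact fun hc => hs (this.1 hc)
    · rintro hl ⟨i, hi⟩
      have := hl i hi
      simp only [D, hi, dite_true] at this
      split_ifs at this with hs
      · exact ⟨fun _ => hs, fun _ => this⟩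
      · exact ⟨fun hc => absurd hc this, fun hc => absurd hc hs⟩
  have hA : Measurable A := measurable_to_countable' fun s => by
    rw [hpre]
    exact MeasurableSet.pi T.countable_toSet fun i _ => hD s i
  have hlaw : ∀ s, (L.map A).real {s} = bernoulliWeight (fun i : T => ν.real (G i)) s := by
    intro s
    rw [map_measureReal_apply hA MeasurableSet.of_discrete, hpre, measureReal_def,
      Measure.infinitePi_pi _ fun i _ => hD s i, ENNReal.toReal_prod]
    unfold bernoulliWeight
    rw [← Finset.prod_coe_sort]
    refine Finset.prod_congr rfl fun i _ => ?_
    simp only [D, i.2, dite_true]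
    split_ifs
    · rfl
    · rw [← measureReal_def, probReal_compl_eq_one_sub (hG i)]
  have hprob : IsProbabilityMeasure (L.map A) := Measure.isProbabilityMeasure_map hA.aemeasurable
  calc ∫ l, h (A l) ∂L = ∫ s, h s ∂(L.map A) :=
        (integral_map hA.aemeasurable (measurable_of_finite h).aestronglyMeasurable).symm
    _ = ∑ s, (L.map A).real {s} * h s := by
        rw [integral_fintype (Integrable.of_finite)]
        rfl
    _ = _ := by simp_rw [hlaw]

/-- Retain each `i : α` with probability `p`, and let the coordinates of `l` be independent. The
events "all of `B r` is retained and all coordinates in `E r` are good" have complements that are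
positively correlated. -/
theorem prod_le_sum_bernoulliWeight_mul_measureReal {α ρ J H : Type*} [Fintype α]
    [DecidableEq α] [MeasurableSpace H] (ν : Measure H) [IsProbabilityMeasure ν] {G : J → Set H}
    (hG : ∀ i, MeasurableSet (G i)) {p : ℝ} (hp0 : 0 ≤ p) (hp1 : p ≤ 1) (R : Finset ρ)
    (B : ρ → Finset α) (E : ρ → Finset J) :
    ∏ r ∈ R, (1 - p ^ (B r).card *
        (Measure.infinitePi fun _ : J => ν).real {l | ∀ i ∈ E r, l i ∈ G i}) ≤
      ∑ S : Finset α, bernoulliWeight (fun _ => p) S *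
        (Measure.infinitePi fun _ : J => ν).real
          {l | ∀ r ∈ R, B r ⊆ S → ¬ ∀ i ∈ E r, l i ∈ G i} := by
  classical
  set L := Measure.infinitePi fun _ : J => ν
  let T : Finset J := R.biUnion E
  let pT : T → ℝ := fun i => ν.real (G i)
  have hset : ∀ E' : Finset J, MeasurableSet {l : J → H | ∀ i ∈ E', l i ∈ G i} := by
    intro E'
    exact MeasurableSet.pi E'.countable_toSet fun i _ => hG i
  let A : (J → H) → Finset T := fun l => Finset.univ.filter fun i : T => l i ∈ G i
  have hA : ∀ r ∈ R, ∀ l, (∀ i ∈ E r, l i ∈ G i) ↔ ∀ i : T, (i : J) ∈ E r → i ∈ A l := by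
    intro r hr l
    constructor
    · intro h i hi
      simpa [A] using h i hi
    · intro h i hi
      simpa [A] using h ⟨i, Finset.mem_biUnion.2 ⟨r, hr, hi⟩⟩ hi
  -- The indicator that event `r` fails, as a function on the product lattice of retained sets and
  -- sets of good coordinates. It is antitone there.
  let f : ρ → Finset α × Finset T → ℝ := fun r a =>
    if B r ⊆ a.1 ∧ ∀ i : T, (i : J) ∈ E r → i ∈ a.2 then 0 else 1
  let w : Finset α × Finset T → ℝ := fun a =>
    bernoulliWeight (fun _ => p) a.1 * bernoulliWeight pT a.2
  have hw1 : ∀ S, 0 ≤ bernoulliWeight (fun _ : α => p) S :=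
    bernoulliWeight_nonneg (fun _ => hp0) fun _ => hp1
  have hw2 : ∀ s, 0 ≤ bernoulliWeight pT s :=
    bernoulliWeight_nonneg (fun _ => measureReal_nonneg) fun _ => measureReal_le_one
  have hwsum : ∑ a, w a = 1 := by
    rw [Fintype.sum_prod_type]
    simp only [w]
    simp_rw [← Finset.mul_sum, sum_bernoulliWeight, mul_one]
    exact sum_bernoulliWeight
  have hfkg := prod_sum_le_sum_prod_of_antitone (w := w)
    (fun a => mul_nonneg (hw1 _) (hw2 _)) hwsum
    (fun a b => by
      simp only [w]
      rw [mul_mul_mul_comm, bernoulliWeight_mul, bernoulliWeight_mul (s := a.2),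
        mul_mul_mul_comm]
      rfl)
    R f (fun r a => by simp only [f]; split_ifs <;> simp)
    (fun r a b hab => by
      simp only [f]
      split_ifs with h1 h2 h2
      · exact le_rfl
      · exact zero_le_one
      · exact absurd ⟨h2.1.trans hab.1, fun i hi => hab.2 (h2.2 i hi)⟩ h1
      · exact le_rfl)
  refine le_trans (le_of_eq ?_) (hfkg.trans (le_of_eq ?_))
  · refine Finset.prod_congr rfl fun r hr => ?_
    let F₁ : Finset α → ℝ := fun S =>
      bernoulliWeight (fun _ => p) S * (if B r ⊆ S then 1 else 0)
    let F₂ : Finset T → ℝ := fun s =>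
      bernoulliWeight pT s * (if ∀ i : T, (i : J) ∈ E r → i ∈ s then 1 else 0)
    -- The indicator that event `r` occurs splits into a retention factor and a fading factor, so
    -- its mean is a product.
    have h1 : ∀ a, w a * f r a = w a - F₁ a.1 * F₂ a.2 := by
      intro a
      simp only [w, f, F₁, F₂]
      split_ifs <;> first | (exfalso; tauto) | ring
    simp_rw [h1]
    rw [Finset.sum_sub_distrib, hwsum, Fintype.sum_prod_type]
    rw [← Finset.sum_mul_sum Finset.univ Finset.univ F₁ F₂, sum_bernoulliWeight_superset,
      Finset.prod_const,
      ← integral_coordinates_mem ν hG T fun s => if ∀ i : T, (i : J) ∈ E r → i ∈ s then 1 else 0]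
    congr 2
    rw [← integral_indicator_one (hset _)]
    refine integral_congr_ae (Filter.Eventually.of_forall fun l => ?_)
    simp only [Set.indicator_apply, Set.mem_ofPred_eq, Pi.one_apply]
    exact if_congr (hA r hr l) rfl rfl
  · rw [Fintype.sum_prod_type]
    refine Finset.sum_congr rfl fun S _ => ?_
    simp only [w]
    simp_rw [mul_assoc, ← Finset.mul_sum]
    congr 1
    rw [← integral_coordinates_mem ν hG T fun s => ∏ r ∈ R, f r (S, s), ← integral_indicator_one]
    · refine integral_congr_ae (Filter.Eventually.of_forall fun l => ?_)
      simp only [Set.indicator_apply, Set.mem_ofPred_eq, Pi.one_apply]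
      split_ifs with h
      · refine Finset.prod_eq_one fun r hr => if_neg ?_
        rintro ⟨hB, hE⟩
        exact h r hr hB ((hA r hr l).2 hE)
      · push Not at h
        obtain ⟨r, hr, hB, hE⟩ := h
        exact Finset.prod_eq_zero hr (if_pos ⟨hB, (hA r hr l).1 hE⟩)
    · have : {l : J → H | ∀ r ∈ R, B r ⊆ S → ¬ ∀ i ∈ E r, l i ∈ G i} =
          ⋂ r ∈ R.filter fun r => B r ⊆ S, {l | ∀ i ∈ E r, l i ∈ G i}ᶜ := by
        ext l
        simp
      rw [this]
      exact Finset.measurableSet_biInter _ fun r _ => (hset _).compl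

/-- From `log y ≥ 1 - 1 / y` at `y = 1 - x`. The constant `1 / (1 - p)` tends to one as `p → 0`, so
nothing is lost in the Poisson limit. -/
theorem exp_neg_div_le_one_sub {x p : ℝ} (hx : 0 ≤ x) (hxp : x ≤ p) (hp : p < 1) :
    Real.exp (-(x / (1 - p))) ≤ 1 - x := by
  have h1 : 0 < 1 - x := by linarith
  rw [← Real.le_log_iff_exp_le h1]
  refine le_trans ?_ (Real.one_sub_inv_le_log_of_pos h1)
  have h2 : x / (1 - x) ≤ x / (1 - p) := div_le_div_of_nonneg_left hx (by linarith) (by linarith)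
  have h3 : 1 - (1 - x)⁻¹ = -(x / (1 - x)) := by field_simp; ring
  rw [h3]
  linarith

/-! ### Potential relay sets in a configuration -/

/-- The fadings for which the hop `a = (t, u, v)` succeeds in the environment `x`. -/
def goodFading {H ι : Type*} [MeasurableSpace H] (C : Channel H) (src dst : Plane)
    (x : Environment H ι) (a : ℕ × Option ι × Option ι) : Set H :=
  {η | (a.2.1.elim src x.1, a.2.2.elim dst x.1, η,
    fun k => (x.2.1 a.1 k, x.2.2 (a.1, k, a.2.2))) ∈ C.success}

/-- The `l`-th hop of the route through the relays `r`. -/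
def routeHop {ι : Type*} {m : ℕ} (τ : Fin (m + 1) → ℕ) (r : Fin m → ι) (l : Fin (m + 1)) :
    ℕ × Option ι × Option ι :=
  (τ l, Fin.cons (α := fun _ => Option ι) none (fun i => some (r i)) l,
    Fin.snoc (α := fun _ => Option ι) (fun i => some (r i)) none l)

/-- The configurations in which the relays `r` form a potential relay set. -/
def potentialSet {H ι : Type*} [MeasurableSpace H] (C : Channel H) (src dst : Plane) {m : ℕ}
    (τ : Fin (m + 1) → ℕ) (F : Set (Fin m → Plane)) (r : Fin m → ι) : Set (Configuration H ι) :=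
  {c | (fun i => c.1.1 (r i)) ∈ F ∧
    ∀ l, c.2 (routeHop τ r l) ∈ goodFading C src dst c.1 (routeHop τ r l)}

/-- The configurations in which no relays among those in `S` form a potential relay set. -/
def outageSet {H ι : Type*} [MeasurableSpace H] (C : Channel H) (src dst : Plane) {m : ℕ}
    (τ : Fin (m + 1) → ℕ) (F : Set (Fin m → Plane)) (S : Set ι) : Set (Configuration H ι) :=
  {c | ∀ r : Fin m ↪ ι, Set.range r ⊆ S → c ∉ potentialSet C src dst τ F r}

section PotentialSet

variable {H ι κ : Type*} [MeasurableSpace H] {C : Channel H} {src dst : Plane} {m : ℕ}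
  {τ : Fin (m + 1) → ℕ} {F : Set (Fin m → Plane)}

theorem routeHop_comp (e : κ → ι) (r : Fin m → κ) (l : Fin (m + 1)) :
    routeHop τ (e ∘ r) l = ((routeHop τ r l).1, (routeHop τ r l).2.1.map e,
      (routeHop τ r l).2.2.map e) := by
  simp only [routeHop, Prod.mk.injEq, true_and]
  constructor
  · refine Fin.cases ?_ (fun i => ?_) l <;> simp
  · refine Fin.lastCases ?_ (fun i => ?_) l <;> simp

theorem goodFading_pull (e : κ → ι) (c : Configuration H ι) (a : ℕ × Option κ × Option κ) :
    goodFading C src dst (c.pull e).1 a =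
      goodFading C src dst c.1 (a.1, a.2.1.map e, a.2.2.map e) := by
  rcases a with ⟨t, _ | u, _ | v⟩ <;> rfl

theorem pull_mem_potentialSet (e : κ → ι) (r : Fin m → κ) (c : Configuration H ι) :
    c.pull e ∈ potentialSet C src dst τ F r ↔ c ∈ potentialSet C src dst τ F (e ∘ r) := by
  simp only [potentialSet, Set.mem_ofPred_eq, goodFading_pull, routeHop_comp]
  rfl

/-- A route inside the image of `e` lifts uniquely through the injection. With the invariance of the
law under relabelling, the outage probability among i.i.d. relays in `S` depends only on the size of
`S`. -/
theorem pull_mem_outageSet (e : κ ↪ ι) (c : Configuration H ι) (S : Set κ) :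
    c.pull e ∈ outageSet C src dst τ F S ↔ c ∈ outageSet C src dst τ F (e '' S) := by
  simp only [outageSet, Set.mem_ofPred_eq, pull_mem_potentialSet]
  constructor
  · intro h r hr
    choose s hs hse using fun i => hr (Set.mem_range_self i)
    have hinj : Function.Injective s := fun i j hij =>
      r.injective (by rw [← hse i, ← hse j, hij])
    have := h ⟨s, hinj⟩ (by rintro _ ⟨i, rfl⟩; exact hs i)
    have hr' : (r : Fin m → ι) = e ∘ s := funext fun i => (hse i).symm
    rw [hr']
    exact this
  · intro h r hr
    have := h (r.trans e) (by
      rintro _ ⟨i, rfl⟩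
      exact ⟨r i, hr ⟨i, rfl⟩, rfl⟩)
    exact this

theorem measurableSet_goodFading (x : Environment H ι) (a : ℕ × Option ι × Option ι) :
    MeasurableSet (goodFading C src dst x a) := by
  have : Measurable fun η : H => (a.2.1.elim src x.1, a.2.2.elim dst x.1, η,
      fun k => (x.2.1 a.1 k, x.2.2 (a.1, k, a.2.2))) := by fun_prop
  exact this C.measurableSet_success

theorem measurableSet_potentialSet (hF : MeasurableSet F) (r : Fin m → ι) :
    MeasurableSet (potentialSet C src dst τ F r) := by
  have h1 : Measurable fun (c : Configuration H ι) (i : Fin m) => c.1.1 (r i) := by fun_prop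
  refine (h1 hF).inter ?_
  have h2 : {c : Configuration H ι |
      ∀ l, c.2 (routeHop τ r l) ∈ goodFading C src dst c.1 (routeHop τ r l)} =
      ⋂ l, {c | c.2 (routeHop τ r l) ∈ goodFading C src dst c.1 (routeHop τ r l)} := by
    ext c; simp
  change MeasurableSet {c : Configuration H ι |
      ∀ l, c.2 (routeHop τ r l) ∈ goodFading C src dst c.1 (routeHop τ r l)}
  rw [h2]
  refine MeasurableSet.iInter fun l => ?_
  have helim : ∀ (x₀ : Plane) (o : Option ι),
      Measurable fun c : Configuration H ι => o.elim x₀ c.1.1 := by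
    rintro x₀ (_ | i)
    · exact measurable_const
    · exact (measurable_pi_apply i).comp (by fun_prop)
  have h3 : Measurable fun c : Configuration H ι =>
      ((routeHop τ r l).2.1.elim src c.1.1, (routeHop τ r l).2.2.elim dst c.1.1,
        c.2 (routeHop τ r l), fun k => (c.1.2.1 (routeHop τ r l).1 k,
          c.1.2.2 ((routeHop τ r l).1, k, (routeHop τ r l).2.2))) :=
    (helim _ _).prodMk ((helim _ _).prodMk (Measurable.prodMk (by fun_prop) (by fun_prop)))
  exact h3 C.measurableSet_success

theorem measurableSet_outageSet [Countable ι] (hF : MeasurableSet F) (S : Set ι) :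
    MeasurableSet (outageSet (H := H) C src dst τ F S) := by
  have : outageSet (H := H) C src dst τ F S =
      ⋂ r ∈ {r : Fin m ↪ ι | Set.range r ⊆ S}, (potentialSet C src dst τ F r)ᶜ := by
    ext c; simp [outageSet]
  have : Countable (Fin m ↪ ι) := DFunLike.coe_injective.countable
  rw [‹outageSet C src dst τ F S = _›]
  exact MeasurableSet.biInter (Set.to_countable _) fun r _ =>
    (measurableSet_potentialSet hF r).compl

theorem measureReal_prod_eq_integral {α β : Type*} [MeasurableSpace α] [MeasurableSpace β]
    (μ : Measure α) [IsFiniteMeasure μ] (ν : Measure β) [IsFiniteMeasure ν] {D : Set (α × β)}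
    (hD : MeasurableSet D) :
    (μ.prod ν).real D = ∫ x, ν.real (Prod.mk x ⁻¹' D) ∂μ := by
  rw [measureReal_def, Measure.prod_apply hD]
  exact (integral_toReal (measurable_measure_prodMk_left hD).aemeasurable
    (Filter.Eventually.of_forall fun x => measure_lt_top _ _)).symm

/-- A lower bound for the outage probability among the retained relays, given the environment. -/
theorem exp_le_sum_bernoulliWeight_mul_measureReal_outageSet (hm : 1 ≤ m) (ν : Measure H)
    [IsProbabilityMeasure ν] {n : ℕ} {p : ℝ} (hp0 : 0 ≤ p) (hp1 : p < 1)
    (x : Environment H (Fin n)) :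
    Real.exp (-(p ^ m / (1 - p) * ∑ r : Fin m ↪ Fin n,
        (Measure.infinitePi fun _ => ν).real (Prod.mk x ⁻¹' potentialSet C src dst τ F r))) ≤
      ∑ S : Finset (Fin n), bernoulliWeight (fun _ => p) S *
        (Measure.infinitePi fun _ => ν).real
          (Prod.mk x ⁻¹' outageSet C src dst τ F (S : Set (Fin n))) := by
  classical
  set L : Measure (ℕ × Option (Fin n) × Option (Fin n) → H) := Measure.infinitePi fun _ => ν
  -- Feasibility is decided by the frozen positions; infeasible routes have conditional probability
  -- zero and are dropped from the product.
  let R : Finset (Fin m ↪ Fin n) := Finset.univ.filter fun r => (fun i => x.1 (r i)) ∈ F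
  let B : (Fin m ↪ Fin n) → Finset (Fin n) := fun r => Finset.univ.map r
  let E : (Fin m ↪ Fin n) → Finset (ℕ × Option (Fin n) × Option (Fin n)) := fun r =>
    Finset.univ.image (routeHop τ r)
  have hharris := prod_le_sum_bernoulliWeight_mul_measureReal ν
    (G := goodFading C src dst x) (measurableSet_goodFading x) hp0 hp1.le R B E
  have hpot : ∀ r ∈ R, Prod.mk x ⁻¹' potentialSet C src dst τ F r =
      {l | ∀ i ∈ E r, l i ∈ goodFading C src dst x i} := by
    intro r hr
    ext l
    have : (fun i => x.1 (r i)) ∈ F := (Finset.mem_filter.1 hr).2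
    simp [potentialSet, E, this]
  have hnot : ∀ r ∉ R, Prod.mk x ⁻¹' potentialSet C src dst τ F r = ∅ := by
    intro r hr
    ext l
    have : (fun i => x.1 (r i)) ∉ F := fun h => hr (Finset.mem_filter.2 ⟨Finset.mem_univ _, h⟩)
    simp [potentialSet, this]
  have hout : ∀ S : Finset (Fin n), Prod.mk x ⁻¹' outageSet C src dst τ F (S : Set (Fin n)) =
      {l | ∀ r ∈ R, B r ⊆ S → ¬ ∀ i ∈ E r, l i ∈ goodFading C src dst x i} := by
    intro S
    ext l
    have hB : ∀ r, B r ⊆ S ↔ Set.range r ⊆ (S : Set (Fin n)) := by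
      intro r
      rw [← Finset.coe_subset]
      simp [B]
    simp only [Set.mem_preimage, outageSet, Set.mem_ofPred_eq, hB]
    constructor
    · intro h r hr hS hl
      refine h r hS ?_
      rw [← Set.mem_preimage (f := Prod.mk x), hpot r hr]
      exact hl
    · intro h r hS hl
      rw [← Set.mem_preimage (f := Prod.mk x)] at hl
      by_cases hr : r ∈ R
      · rw [hpot r hr] at hl
        exact h r hr hS hl
      · rw [hnot r hr] at hl
        exact hl
  have hp1' : 0 < 1 - p := by linarith
  calc Real.exp (-(p ^ m / (1 - p) * ∑ r : Fin m ↪ Fin n,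
        L.real (Prod.mk x ⁻¹' potentialSet C src dst τ F r)))
      = ∏ r ∈ R, Real.exp (-(p ^ m * L.real {l | ∀ i ∈ E r, l i ∈ goodFading C src dst x i} /
          (1 - p))) := by
        rw [← Real.exp_sum, Finset.sum_neg_distrib, Finset.mul_sum,
          ← Finset.sum_subset (Finset.subset_univ R)]
        · congr 2
          refine Finset.sum_congr rfl fun r hr => ?_
          rw [hpot r hr]
          ring
        · intro r _ hr
          simp [hnot r hr]
    _ ≤ ∏ r ∈ R, (1 - p ^ m * L.real {l | ∀ i ∈ E r, l i ∈ goodFading C src dst x i}) := by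
        refine Finset.prod_le_prod (fun r _ => (Real.exp_pos _).le) fun r _ => ?_
        refine exp_neg_div_le_one_sub (by positivity) ?_ hp1
        refine (mul_le_of_le_one_right (by positivity) measureReal_le_one).trans ?_
        -- Here `1 ≤ m` enters: it puts the probability of each event below `p`, as the exponential
        -- bound requires.
        calc p ^ m ≤ p ^ 1 := pow_le_pow_of_le_one hp0 hp1.le hm
          _ = p := pow_one p
    _ ≤ _ := by
        simp_rw [hout]
        simpa [B] using hharris

/-- The outage probability for `n` independent relays, each retained with probability `p`. -/
theorem exp_le_sum_binomial_outageSet (hm : 1 ≤ m) (hF : MeasurableSet F) (u : Measure Plane)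
    [IsProbabilityMeasure u] (Q : Measure (ℕ → ℕ → Plane)) [IsProbabilityMeasure Q] (ν : Measure H)
    [IsProbabilityMeasure ν] (n : ℕ) {p : ℝ} (hp0 : 0 ≤ p) (hp1 : p < 1) :
    Real.exp (-(p ^ m / (1 - p) * (n.descFactorial m *
        (configurationLaw (Measure.infinitePi fun _ => u) Q ν).real
          (potentialSet C src dst τ F (id : Fin m → Fin m))))) ≤
      ∑ k ∈ Finset.range (n + 1), n.choose k * p ^ k * (1 - p) ^ (n - k) *
        (configurationLaw (Measure.infinitePi fun _ => u) Q ν).real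
          (outageSet C src dst τ F (Set.univ : Set (Fin k))) := by
  classical
  set En : Measure (Environment H (Fin n)) :=
    environmentLaw (Measure.infinitePi fun _ : Fin n => u) Q ν
  set L : Measure (ℕ × Option (Fin n) × Option (Fin n) → H) := Measure.infinitePi fun _ => ν
  set μ : Measure (Configuration H (Fin n)) :=
    configurationLaw (Measure.infinitePi fun _ : Fin n => u) Q ν
  have hμ : μ = En.prod L := rfl
  set a := (configurationLaw (Measure.infinitePi fun _ => u) Q ν).real
    (potentialSet C src dst τ F (id : Fin m → Fin m))
  set q : ℕ → ℝ := fun k => (configurationLaw (Measure.infinitePi fun _ => u) Q ν).real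
    (outageSet C src dst τ F (Set.univ : Set (Fin k)))
  have hPm : ∀ r : Fin m ↪ Fin n, MeasurableSet (potentialSet (H := H) C src dst τ F r) :=
    fun r => measurableSet_potentialSet hF r
  have hOm : ∀ S : Finset (Fin n),
      MeasurableSet (outageSet (H := H) C src dst τ F (S : Set (Fin n))) :=
    fun S => measurableSet_outageSet hF _
  -- By exchangeability all `n.descFactorial m` routes have the same probability.
  have hpot : ∀ r : Fin m ↪ Fin n, μ.real (potentialSet C src dst τ F r) = a := by
    intro r
    simp only [a]
    rw [← map_pull_configurationLaw_infinitePi r.injective u Q ν,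
      map_measureReal_apply (Configuration.measurable_pull _) (measurableSet_potentialSet hF _)]
    congr 1
    ext c
    rw [Set.mem_preimage, pull_mem_potentialSet]
    rfl
  have hout : ∀ S : Finset (Fin n),
      μ.real (outageSet C src dst τ F (S : Set (Fin n))) = q S.card := by
    intro S
    simp only [q]
    rw [← map_pull_configurationLaw_infinitePi (S.orderEmbOfFin rfl).injective u Q ν,
      map_measureReal_apply (Configuration.measurable_pull _) (measurableSet_outageSet hF _)]
    congr 1
    ext c
    rw [Set.mem_preimage]
    have := pull_mem_outageSet (C := C) (src := src) (dst := dst) (τ := τ) (F := F)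
      (S.orderEmbOfFin rfl).toEmbedding c Set.univ
    simp only [RelEmbedding.coe_toEmbedding, Set.image_univ, Finset.range_orderEmbOfFin] at this
    exact this.symm
  have hPint : ∀ r : Fin m ↪ Fin n,
      Integrable (fun x => L.real (Prod.mk x ⁻¹' potentialSet C src dst τ F r)) En := fun r =>
    Integrable.of_bound (measurable_measure_prodMk_left (hPm r)).ennreal_toReal.aestronglyMeasurable
      1 (Filter.Eventually.of_forall fun x => by
        rw [Real.norm_of_nonneg measureReal_nonneg]; exact measureReal_le_one)
  have hOint : ∀ S : Finset (Fin n), Integrable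
      (fun x => L.real (Prod.mk x ⁻¹' outageSet C src dst τ F (S : Set (Fin n)))) En := fun S =>
    Integrable.of_bound (measurable_measure_prodMk_left (hOm S)).ennreal_toReal.aestronglyMeasurable
      1 (Filter.Eventually.of_forall fun x => by
        rw [Real.norm_of_nonneg measureReal_nonneg]; exact measureReal_le_one)
  set φ : Environment H (Fin n) → ℝ := fun x => -(p ^ m / (1 - p) * ∑ r : Fin m ↪ Fin n,
    L.real (Prod.mk x ⁻¹' potentialSet C src dst τ F r)) with hφ
  have hφint : Integrable φ En := ((integrable_finsetSum _ fun r _ => hPint r).const_mul _).neg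
  have hφ0 : ∀ x, φ x ≤ 0 := fun x => by
    have : 0 < 1 - p := by linarith
    simp only [hφ, Left.neg_nonpos_iff]
    positivity
  have hexpint : Integrable (Real.exp ∘ φ) En :=
    Integrable.of_bound (Real.continuous_exp.comp_aestronglyMeasurable hφint.aestronglyMeasurable)
      1 (Filter.Eventually.of_forall fun x => by
        rw [Function.comp_apply, Real.norm_of_nonneg (Real.exp_pos _).le]
        exact Real.exp_le_one_iff.2 (hφ0 x))
  have hφmean : ∫ x, φ x ∂En = -(p ^ m / (1 - p) * (n.descFactorial m * a)) := by
    simp only [hφ]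
    rw [integral_neg, integral_const_mul, integral_finsetSum _ fun r _ => hPint r]
    simp_rw [← measureReal_prod_eq_integral En L (hPm _), ← hμ, hpot]
    simp [Fintype.card_embedding_eq]
  rw [← hφmean]
  -- Jensen's inequality for the convex exponential, followed by the bound for each frozen
  -- environment.
  calc Real.exp (∫ x, φ x ∂En) ≤ ∫ x, Real.exp (φ x) ∂En :=
        convexOn_exp.map_integral_le Real.continuous_exp.continuousOn isClosed_univ
          (Filter.Eventually.of_forall fun _ => Set.mem_univ _) hφint hexpint
    _ ≤ ∫ x, ∑ S : Finset (Fin n), bernoulliWeight (fun _ => p) S *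
          L.real (Prod.mk x ⁻¹' outageSet C src dst τ F (S : Set (Fin n))) ∂En :=
        integral_mono hexpint (integrable_finsetSum _ fun S _ => (hOint S).const_mul _) fun x =>
          exp_le_sum_bernoulliWeight_mul_measureReal_outageSet hm ν hp0 hp1 x
    _ = ∑ S : Finset (Fin n), bernoulliWeight (fun _ => p) S * q S.card := by
        rw [integral_finsetSum _ fun S _ => (hOint S).const_mul _]
        simp_rw [integral_const_mul, ← measureReal_prod_eq_integral En L (hOm _), ← hμ, hout]
    _ = _ := by
        simp_rw [bernoulliWeight_const, Fintype.card_fin]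
        rw [← Finset.powerset_univ, Finset.sum_powerset_apply_card
          (fun k => p ^ k * (1 - p) ^ (n - k) * q k)]
        simp [mul_assoc, q]

end PotentialSet

/-! ### From binomial to Poisson -/

-- Take `p = r / n`. The binomial weights converge to the Poisson ones and are dominated by the
-- summable `r ^ k / k!`. In the exponent, `p ^ m * n.descFactorial m ≤ (n * p) ^ m = r ^ m` and `1
-- - p → 1`.
open Filter Topology in
theorem exp_le_tsum_poisson_of_forall_binomial {q : ℕ → ℝ} (hq0 : ∀ k, 0 ≤ q k)
    (hq1 : ∀ k, q k ≤ 1) {a : ℝ} (ha : 0 ≤ a) {m : ℕ}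
    (h : ∀ (n : ℕ) (p : ℝ), 0 ≤ p → p < 1 →
      Real.exp (-(p ^ m / (1 - p) * (n.descFactorial m * a))) ≤
        ∑ k ∈ Finset.range (n + 1), n.choose k * p ^ k * (1 - p) ^ (n - k) * q k)
    {r : ℝ} (hr : 0 ≤ r) :
    Real.exp (-(r ^ m * a)) ≤ ∑' k : ℕ, Real.exp (-r) * r ^ k / k.factorial * q k := by
  let p : ℕ → ℝ := fun n => r / n
  have hp0 : ∀ n, 0 ≤ p n := fun n => by positivity
  have hplim : Tendsto p atTop (𝓝 0) := tendsto_const_div_atTop_nhds_zero_nat r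
  have hplt : ∀ᶠ n in atTop, p n < 1 := hplim.eventually (Iio_mem_nhds zero_lt_one)
  have hnp : ∀ᶠ n : ℕ in atTop, n * p n = r := by
    filter_upwards [eventually_ge_atTop 1] with n hn
    have : (n : ℝ) ≠ 0 := by positivity
    simp only [p]
    field_simp
  have hnplim : Tendsto (fun n : ℕ => n * p n) atTop (𝓝 r) :=
    tendsto_const_nhds.congr' (hnp.mono fun n hn => hn.symm)
  have hL : Tendsto (fun n => Real.exp (-(r ^ m * a / (1 - p n)))) atTop
      (𝓝 (Real.exp (-(r ^ m * a)))) := by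
    have h1 : Tendsto (fun n => r ^ m * a / (1 - p n)) atTop (𝓝 (r ^ m * a / (1 - 0))) :=
      tendsto_const_nhds.div (tendsto_const_nhds.sub hplim) (by norm_num)
    rw [sub_zero, div_one] at h1
    exact (Real.continuous_exp.tendsto _).comp h1.neg
  have hR : Tendsto (fun n : ℕ => ∑' k : ℕ, n.choose k * p n ^ k * (1 - p n) ^ (n - k) * q k) atTop
      (𝓝 (∑' k : ℕ, Real.exp (-r) * r ^ k / k.factorial * q k)) := by
    refine tendsto_tsum_of_dominated_convergence (bound := fun k => r ^ k / k.factorial)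
      (Real.summable_pow_div_factorial r)
      (fun k => (tendsto_choose_mul_pow_of_tendsto_mul_atTop k hnplim).mul_const _) ?_
    filter_upwards [hplt, hnp] with n hn1 hn2 k
    have h1p : 0 ≤ 1 - p n := by linarith
    have hnn : 0 ≤ (n.choose k : ℝ) * p n ^ k :=
      mul_nonneg (Nat.cast_nonneg _) (pow_nonneg (hp0 n) k)
    rw [Real.norm_of_nonneg (mul_nonneg (mul_nonneg hnn (pow_nonneg h1p _)) (hq0 k))]
    calc (n.choose k : ℝ) * p n ^ k * (1 - p n) ^ (n - k) * q k
        ≤ n.choose k * p n ^ k * 1 * 1 := by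
          gcongr
          · exact hq0 k
          · exact pow_le_one₀ h1p (by linarith [hp0 n])
          · exact hq1 k
      _ ≤ n ^ k / k.factorial * p n ^ k := by
          rw [mul_one, mul_one]
          exact mul_le_mul_of_nonneg_right (Nat.choose_le_pow_div k n) (pow_nonneg (hp0 n) k)
      _ = r ^ k / k.factorial := by rw [← hn2, mul_pow]; ring
  refine le_of_tendsto_of_tendsto hL hR ?_
  filter_upwards [hplt, hnp] with n hn1 hn2
  have h1p : 0 < 1 - p n := by linarith
  have htsum : ∑' k : ℕ, (n.choose k : ℝ) * p n ^ k * (1 - p n) ^ (n - k) * q k =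
      ∑ k ∈ Finset.range (n + 1), n.choose k * p n ^ k * (1 - p n) ^ (n - k) * q k := by
    refine tsum_eq_sum fun k hk => ?_
    rw [Nat.choose_eq_zero_of_lt (by simpa using hk)]
    simp
  rw [htsum]
  refine le_trans (Real.exp_le_exp.2 (neg_le_neg ?_)) (h n (p n) (hp0 n) hn1)
  have hdesc : (n.descFactorial m : ℝ) ≤ n ^ m := by exact_mod_cast Nat.descFactorial_le_pow n m
  calc p n ^ m / (1 - p n) * (n.descFactorial m * a)
      ≤ p n ^ m / (1 - p n) * (n ^ m * a) := by
        have := hp0 n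
        gcongr
    _ = (n * p n) ^ m * a / (1 - p n) := by rw [mul_pow]; ring
    _ = r ^ m * a / (1 - p n) := by rw [hn2]

/-- A lower bound on the factorial moments of a Poisson variable. -/
theorem ofReal_pow_le_tsum_poisson_mul_descFactorial (r : ℝ≥0) (m : ℕ) :
    ENNReal.ofReal ((r : ℝ) ^ m) ≤ ∑' k : ℕ, poissonMeasure r {k} * (k.descFactorial m : ℝ≥0∞) := by
  have hone : ∑' j : ℕ, poissonMeasure r {j} = 1 := by
    rw [← measure_univ (μ := poissonMeasure r), ← Set.iUnion_of_singleton ℕ,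
      measure_iUnion (fun i j hij => by simpa using hij) fun _ => MeasurableSet.of_discrete]
  calc ENNReal.ofReal ((r : ℝ) ^ m)
      = ∑' j : ℕ, ENNReal.ofReal ((r : ℝ) ^ m) * poissonMeasure r {j} := by
        rw [ENNReal.tsum_mul_left, hone, mul_one]
    -- The descending factorial cancels part of `(j + m)!`, so the Poisson mass at `j + m` becomes
    -- `r ^ m` times the mass at `j`.
    _ = ∑' j : ℕ, poissonMeasure r {j + m} * ((j + m).descFactorial m : ℝ≥0∞) := by
        refine tsum_congr fun j => ?_
        rw [poissonMeasure_singleton, poissonMeasure_singleton, ← ENNReal.ofReal_natCast,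
          ← ENNReal.ofReal_mul (by positivity), ← ENNReal.ofReal_mul (by positivity)]
        congr 1
        have h1 : ((j.factorial : ℝ)) * ((j + m).descFactorial m : ℝ) = ((j + m).factorial : ℝ) := by
          have := Nat.factorial_mul_descFactorial (Nat.le_add_left m j)
          rw [Nat.add_sub_cancel] at this
          exact_mod_cast this
        have h2 : ((j.factorial : ℝ)) ≠ 0 := by positivity
        have h3 : (((j + m).factorial : ℝ)) ≠ 0 := by positivity
        rw [← h1] at h3 ⊢
        have h4 := right_ne_zero_of_mul h3
        field_simp
        ring
    _ ≤ _ := ENNReal.tsum_comp_le_tsum_of_injective (add_left_injective m)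
        fun k => poissonMeasure r {k} * (k.descFactorial m : ℝ≥0∞)

/-! ### Relays in a bounded window -/

namespace RelayNetwork

section

variable {Ω H : Type*} [MeasurableSpace H]

/-- The label `none` stands for the source as a transmitter and for the destination as a receiver;
under this dictionary the two descriptions agree hop by hop. -/
theorem isPotential_iff (N : RelayNetwork Ω H) (C : Channel H) {m : ℕ} (τ : Fin (m + 1) → ℕ)
    (F : Set (Fin m → Plane)) (r : Fin m ↪ ℕ) (ω : Ω) :
    N.IsPotential C τ F r ω ↔ N.configuration ω ∈ potentialSet C N.src N.dst τ F r := by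
  refine and_congr Iff.rfl (forall_congr' fun l => ?_)
  have hpos : ∀ l, (Fin.cons (α := fun _ => Plane) N.src (fun i => N.relay (r i) ω) l : Plane) =
      (Fin.cons (α := fun _ => Option ℕ) none (fun i => some (r i)) l : Option ℕ).elim N.src
        fun i => N.relay i ω :=
    fun l => by refine Fin.cases ?_ (fun i => ?_) l <;> simp
  have hpos' : ∀ l, (Fin.snoc (α := fun _ => Plane) (fun i => N.relay (r i) ω) N.dst l : Plane) =
      (Fin.snoc (α := fun _ => Option ℕ) (fun i => some (r i)) none l : Option ℕ).elim N.dst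
        fun i => N.relay i ω :=
    fun l => by refine Fin.lastCases ?_ (fun i => ?_) l <;> simp
  have htr : ∀ l, (Fin.cons (α := fun _ => Transmitter) Transmitter.source
      (fun i => Transmitter.relay (r i)) l : Transmitter) =
      transmitterOf (Fin.cons (α := fun _ => Option ℕ) none (fun i => some (r i)) l) :=
    fun l => by refine Fin.cases ?_ (fun i => ?_) l <;> simp [transmitterOf]
  have hre : ∀ l, (Fin.snoc (α := fun _ => Receiver) (fun i => Receiver.relay (r i))
      Receiver.destination l : Receiver) =
      receiverOf (Fin.snoc (α := fun _ => Option ℕ) (fun i => some (r i)) none l) :=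
    fun l => by refine Fin.lastCases ?_ (fun i => ?_) l <;> simp [receiverOf]
  rw [hpos, hpos', htr, hre]
  rfl

variable [MeasurableSpace Ω] {N : RelayNetwork Ω H} {P : Measure Ω} [IsProbabilityMeasure P]
  {ν : Measure H} [IsProbabilityMeasure ν] {lam gam : ℝ}

theorem IsPoissonModel.outageProb_eq (hN : N.IsPoissonModel P ν lam gam) (C : Channel H) {m : ℕ}
    (τ : Fin (m + 1) → ℕ) {F : Set (Fin m → Plane)} (hF : MeasurableSet F) :
    N.outageProb P C τ F =
      configurationLaw (P.map fun ω i => N.relay i ω) (P.map fun ω t k => N.interferer t k ω) ν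
        (outageSet C N.src N.dst τ F Set.univ) := by
  rw [← hN.map_configuration, Measure.map_apply hN.measurable_configuration
    (measurableSet_outageSet hF _)]
  unfold outageProb
  congr 1
  ext ω
  simp [outageSet, isPotential_iff]

theorem IsPoissonModel.expectedPotentialCount_eq (hN : N.IsPoissonModel P ν lam gam)
    (C : Channel H) {m : ℕ} (τ : Fin (m + 1) → ℕ) {F : Set (Fin m → Plane)}
    (hF : MeasurableSet F) :
    N.expectedPotentialCount P C τ F =
      ∫⁻ w, (({r : Fin m ↪ ℕ | w ∈ potentialSet C N.src N.dst τ F r}.encard : ℕ∞) : ℝ≥0∞)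
        ∂(configurationLaw (P.map fun ω i => N.relay i ω)
          (P.map fun ω t k => N.interferer t k ω) ν) := by
  have hm : Measurable fun w : Configuration H ℕ =>
      (({r : Fin m ↪ ℕ | w ∈ potentialSet C N.src N.dst τ F r}.encard : ℕ∞) : ℝ≥0∞) := by
    simp_rw [encard_eq_tsum_indicator]
    exact Measurable.tsum fun r => measurable_one.indicator (measurableSet_potentialSet hF r)
  rw [← hN.map_configuration, lintegral_map hm hN.measurable_configuration]
  simp only [expectedPotentialCount, potentialCount, isPotential_iff]

/-- The outage bound when only relays in a window of finite area are feasible. -/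
theorem IsPoissonModel.exp_neg_le_outageProb_of_window (hN : N.IsPoissonModel P ν lam gam)
    (hc : 0 < (1 - gam) * lam) (C : Channel H) {m : ℕ} (hm : 1 ≤ m) (τ : Fin (m + 1) → ℕ)
    {F : Set (Fin m → Plane)} (hF : MeasurableSet F) {B : Set Plane} (hB : MeasurableSet B)
    (hBfin : volume B ≠ ∞) (hBpos : volume B ≠ 0) (hFB : ∀ z ∈ F, ∀ i, z i ∈ B) :
    EReal.exp (-((N.expectedPotentialCount P C τ F : ℝ≥0∞) : EReal)) ≤ N.outageProb P C τ F := by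
  set c := (1 - gam) * lam
  have hXm : Measurable fun ω i => N.relay i ω := measurable_pi_iff.2 hN.relay_poisson.measurable
  have hYm : Measurable fun ω t k => N.interferer t k ω :=
    measurable_pi_iff.2 fun t => measurable_pi_iff.2 (hN.interferer_poisson t).measurable
  set Q := P.map fun ω t k => N.interferer t k ω with hQ
  have : IsProbabilityMeasure Q := Measure.isProbabilityMeasure_map hYm.aemeasurable
  set u : Measure Plane := volume[|B] with hu
  have : IsProbabilityMeasure u := cond_isProbabilityMeasure_of_finite hBpos hBfin
  have huB : ∀ D, MeasurableSet D → c * volume.real (B ∩ D) = c * volume.real B * u.real D := by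
    intro D _
    have : volume.real B ≠ 0 := (measureReal_ne_zero_iff hBfin).2 hBpos
    rw [hu, measureReal_def (μ := volume[|B]), cond_apply hB,
      ENNReal.toReal_mul, ENNReal.toReal_inv, ← measureReal_def, ← measureReal_def]
    field_simp
  set r : ℝ≥0 := Real.toNNReal (c * volume.real B) with hr
  set a := (configurationLaw (Measure.infinitePi fun _ => u) Q ν).real
    (potentialSet C N.src N.dst τ F (id : Fin m → Fin m)) with ha
  set q : ℕ → ℝ := fun k => (configurationLaw (Measure.infinitePi fun _ => u) Q ν).real
    (outageSet C N.src N.dst τ F (Set.univ : Set (Fin k))) with hq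
  have hbin := exp_le_tsum_poisson_of_forall_binomial (q := q) (fun k => measureReal_nonneg)
    (fun k => measureReal_le_one) (a := a) measureReal_nonneg (m := m)
    (fun n p hp0 hp1 => exp_le_sum_binomial_outageSet hm hF u Q ν n hp0 hp1) r.coe_nonneg
  -- Only relays in `B` can take part in a route, so outage and count are functionals of the points
  -- in `B`, as conditioning on their number requires.
  have hrange : ∀ (w : Configuration H ℕ) (r : Fin m ↪ ℕ),
      w ∈ potentialSet C N.src N.dst τ F r → Set.range r ⊆ {i | w.1.1 i ∈ B} := by
    rintro w r hw _ ⟨i, rfl⟩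
    exact hFB _ hw.1 i
  have hout : N.outageProb P C τ F = ∑' k : ℕ, poissonMeasure r {k} *
      configurationLaw (Measure.infinitePi fun _ => u) Q ν
        (outageSet C N.src N.dst τ F (Set.univ : Set (Fin k))) := by
    rw [hN.outageProb_eq C τ hF, ← lintegral_indicator_one (measurableSet_outageSet hF _),
      hN.relay_poisson.lintegral_configurationLaw_eq_tsum hc hB hBfin huB Q ν
        (g := fun k => (outageSet C N.src N.dst τ F (Set.univ : Set (Fin k))).indicator 1)
        (fun k => measurable_one.indicator (measurableSet_outageSet hF _))]
    · refine tsum_congr fun k => ?_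
      congr 1
      exact lintegral_indicator_one (measurableSet_outageSet hF _)
    · intro w k e he
      classical
      simp only [Set.indicator_apply, pull_mem_outageSet, Set.image_univ, he]
      refine if_congr ⟨fun h r _ => h r (Set.subset_univ _), fun h r _ hw => ?_⟩ rfl rfl
      exact h r (hrange w r hw) hw
  have hcount : N.expectedPotentialCount P C τ F = ∑' k : ℕ, poissonMeasure r {k} *
      ((k.descFactorial m : ℝ≥0∞) * ENNReal.ofReal a) := by
    have hgm : ∀ k, Measurable fun w : Configuration H (Fin k) =>
        (({r : Fin m ↪ Fin k | w ∈ potentialSet C N.src N.dst τ F r}.encard : ℕ∞) : ℝ≥0∞) := by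
      intro k
      simp_rw [encard_eq_tsum_indicator]
      exact Measurable.tsum fun r => measurable_one.indicator (measurableSet_potentialSet hF r)
    rw [hN.expectedPotentialCount_eq C τ hF,
      hN.relay_poisson.lintegral_configurationLaw_eq_tsum hc hB hBfin huB Q ν hgm]
    · refine tsum_congr fun k => ?_
      congr 1
      rw [← tsum_measure_eq_lintegral_encard _ fun r : Fin m ↪ Fin k =>
        measurableSet_potentialSet hF r]
      have hpot : ∀ r : Fin m ↪ Fin k, configurationLaw (Measure.infinitePi fun _ => u) Q ν
          (potentialSet C N.src N.dst τ F r) = ENNReal.ofReal a := by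
        intro r
        rw [ha, ofReal_measureReal, ← map_pull_configurationLaw_infinitePi r.injective u Q ν,
          Measure.map_apply (Configuration.measurable_pull _) (measurableSet_potentialSet hF _)]
        congr 1
        ext w
        rw [Set.mem_preimage, pull_mem_potentialSet]
        rfl
      simp_rw [hpot]
      simp [tsum_fintype, Fintype.card_embedding_eq]
    · intro w k e he
      have himg : {r : Fin m ↪ ℕ | w ∈ potentialSet C N.src N.dst τ F r} =
          (fun s : Fin m ↪ Fin k => s.trans e) ''
            {s | w.pull e ∈ potentialSet C N.src N.dst τ F s} := by
        ext r
        constructor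
        · intro hw
          have hr := hrange w r hw
          rw [← he] at hr
          choose s hs using fun i => hr (Set.mem_range_self i)
          have hinj : Function.Injective s := fun i j hij =>
            r.injective (by rw [← hs i, ← hs j, hij])
          have hsr : (⟨s, hinj⟩ : Fin m ↪ Fin k).trans e = r := by
            ext i
            exact hs i
          refine ⟨⟨s, hinj⟩, ?_, hsr⟩
          rw [Set.mem_ofPred_eq, pull_mem_potentialSet]
          rw [← hsr] at hw
          exact hw
        · rintro ⟨s, hs, rfl⟩
          rw [Set.mem_ofPred_eq, pull_mem_potentialSet] at hs
          exact hs
      have hinj : Function.Injective fun s : Fin m ↪ Fin k => s.trans e := by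
        intro s s' h
        ext i
        have := DFunLike.congr_fun h i
        exact congrArg Fin.val (e.injective this)
      rw [himg, hinj.encard_image]
  -- A lower bound on the mean count suffices, since `exp (-x)` is decreasing. It also covers an
  -- infinite mean.
  have hle : ENNReal.ofReal ((r : ℝ) ^ m * a) ≤ N.expectedPotentialCount P C τ F := by
    rw [hcount, ENNReal.ofReal_mul (by positivity)]
    simp_rw [← mul_assoc]
    rw [ENNReal.tsum_mul_right]
    gcongr
    exact ofReal_pow_le_tsum_poisson_mul_descFactorial r m
  have hbound : ENNReal.ofReal (Real.exp (-((r : ℝ) ^ m * a))) ≤ N.outageProb P C τ F := by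
    refine (ENNReal.ofReal_le_ofReal hbin).trans (le_of_eq ?_)
    have hsummable : Summable fun k : ℕ => Real.exp (-r) * (r : ℝ) ^ k / k.factorial * q k := by
      refine Summable.of_nonneg_of_le (fun k => mul_nonneg (by positivity) measureReal_nonneg)
        (fun k => mul_le_of_le_one_right (by positivity) measureReal_le_one)
        (hasSum_one_poissonMeasure r).summable
    rw [hout, ENNReal.ofReal_tsum_of_nonneg
      (fun k => mul_nonneg (by positivity) measureReal_nonneg) hsummable]
    refine tsum_congr fun k => ?_
    rw [ENNReal.ofReal_mul (by positivity), poissonMeasure_singleton, ofReal_measureReal]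
  refine le_trans ?_ hbound
  calc EReal.exp (-((N.expectedPotentialCount P C τ F : ℝ≥0∞) : EReal))
      ≤ EReal.exp (-((ENNReal.ofReal ((r : ℝ) ^ m * a) : ℝ≥0∞) : EReal)) := by
        refine EReal.exp_monotone (EReal.neg_le_neg_iff.2 ?_)
        exact_mod_cast hle
    _ = ENNReal.ofReal (Real.exp (-((r : ℝ) ^ m * a))) := by
        rw [EReal.coe_ennreal_ofReal, max_eq_left (mul_nonneg (by positivity) measureReal_nonneg),
          ← EReal.coe_neg, EReal.exp_coe]

end

end RelayNetwork

/-! ### Exhausting the plane by bounded windows -/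

theorem theorem1 {Ω H : Type*} [MeasurableSpace Ω] [MeasurableSpace H]
    (P : Measure Ω) [IsProbabilityMeasure P] (ν : Measure H) [IsProbabilityMeasure ν]
    (lam gam : ℝ) (hlam : 0 < lam) (hgam0 : 0 < gam) (hgam1 : gam < 1)
    (N : RelayNetwork Ω H) (hN : N.IsPoissonModel P ν lam gam)
    (C : Channel H) (m : ℕ) (hm : 1 ≤ m) (τ : Fin (m + 1) → ℕ)
    (F : Set (Fin m → Plane)) (hF : MeasurableSet F) :
    EReal.exp (-((N.expectedPotentialCount P C τ F : ℝ≥0∞) : EReal)) ≤ N.outageProb P C τ F := by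
  have hc : 0 < (1 - gam) * lam := mul_pos (by linarith) hlam
  -- The radius `R + 1` keeps the area positive at `R = 0`.
  let W : ℕ → Set (Fin m → Plane) := fun R =>
    F ∩ Set.pi Set.univ fun _ => Metric.closedBall (0 : Plane) (R + 1)
  have hW : ∀ R, MeasurableSet (W R) := fun R =>
    hF.inter (MeasurableSet.univ_pi fun _ => measurableSet_closedBall)
  have hWmono : Monotone W := fun R R' hRR => Set.inter_subset_inter_right _ <|
    Set.pi_mono fun _ _ => Metric.closedBall_subset_closedBall (by gcongr)
  have hbound : ∀ R, EReal.exp (-((N.expectedPotentialCount P C τ F : ℝ≥0∞) : EReal)) ≤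
      N.outageProb P C τ (W R) := by
    intro R
    refine le_trans ?_ (hN.exp_neg_le_outageProb_of_window hc C hm τ (hW R)
      measurableSet_closedBall (measure_closedBall_lt_top (x := (0 : Plane)) (r := R + 1)).ne
      (Metric.measure_closedBall_pos volume _ (by positivity)).ne'
      fun z hz i => hz.2 i (Set.mem_univ i))
    -- Shrinking the feasible region lowers the mean count, so the bound with the full mean holds
    -- for every window.
    refine EReal.exp_monotone (EReal.neg_le_neg_iff.2 ?_)
    have : N.expectedPotentialCount P C τ (W R) ≤ N.expectedPotentialCount P C τ F := by
      refine lintegral_mono fun ω => ?_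
      have hsub : {r : Fin m ↪ ℕ | N.IsPotential C τ (W R) r ω} ⊆
          {r | N.IsPotential C τ F r ω} := fun r hr => ⟨hr.1.1, hr.2⟩
      exact ENat.toENNReal_le.2 (Set.encard_le_encard hsub)
    exact_mod_cast this
  -- A route has finitely many relays and so lies in some ball. Hence the outage events of the
  -- windows decrease to that of `F`, and continuity from above applies.
  have hlim : Filter.Tendsto (fun R => N.outageProb P C τ (W R)) Filter.atTop
      (nhds (N.outageProb P C τ F)) := by
    have hinter : {ω | ∀ r : Fin m ↪ ℕ, ¬ N.IsPotential C τ F r ω} =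
        ⋂ R, {ω | ∀ r : Fin m ↪ ℕ, ¬ N.IsPotential C τ (W R) r ω} := by
      ext ω
      simp only [Set.mem_ofPred_eq, Set.mem_iInter]
      constructor
      · intro h R r hr
        exact h r ⟨hr.1.1, hr.2⟩
      · intro h r hr
        obtain ⟨R, hR⟩ := exists_nat_ge (∑ i, ‖N.relay (r i) ω‖)
        refine h R r ⟨⟨hr.1, fun i _ => ?_⟩, hr.2⟩
        rw [mem_closedBall_zero_iff]
        have := Finset.single_le_sum (f := fun i => ‖N.relay (r i) ω‖)
          (fun i _ => norm_nonneg _) (Finset.mem_univ i)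
        linarith
    unfold RelayNetwork.outageProb
    rw [hinter]
    refine tendsto_measure_iInter_atTop (fun R => ?_) (fun R R' hRR ω hω r hr => ?_)
      ⟨0, measure_ne_top _ _⟩
    · have : {ω | ∀ r : Fin m ↪ ℕ, ¬ N.IsPotential C τ (W R) r ω} =
          N.configuration ⁻¹' outageSet C N.src N.dst τ (W R) Set.univ := by
        ext ω
        simp [outageSet, RelayNetwork.isPotential_iff]
      rw [this]
      exact (hN.measurable_configuration (measurableSet_outageSet (hW R) _)).nullMeasurableSet
    · exact hω r ⟨hWmono hRR hr.1, hr.2⟩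
  exact ge_of_tendsto' hlim hbound

end
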